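/- Let $\mathcal O=(0,1)^2$, let $\|\cdot\|$, $(\cdot,\cdot)$ be the norm and inner product of $L^2(\mathcal O)$ (of scalar, vector or matrix fields), and let $\mathbf H$ be the set of $\boldsymbol v\in L^2(\mathcal O;\mathbb R^2)$ with $\nabla\cdot\boldsymbol v=0$ (weakly). On a filtered probability space $(\Omega,\mathcal F,\{\mathcal F_t\}_{t\ge0},\mathbf P)$ let $W(t)=\sum_{j}\sqrt{q_j}\,\boldsymbol e_j\beta_j(t)$ be a $Q$-Wiener process in $L^2(\mathcal O;\mathbb R^2)$, where $(q_j,\boldsymbol e_j)_{j\ge 1}$ are eigenpairs of a symmetric nonnegative operator $Q$ with $(\boldsymbol e_j)$ an orthonormal basis and $\mathrm{Tr}(Q)=\sum_j q_j<\infty$, and the $\beta_j$ are independent standard Brownian motions with respect to $\{\mathcal F_t\}$. Let $g$ map $\mathbf H$ to bounded $2\times2$ matrix fields on $\mathcal O$, acting on vector fields by pointwise multiplication, and suppose (Assumption 1) that for some $C_g>0$ and all $\boldsymbol u,\boldsymbol v\in\mathbf H$ $$\|g(\boldsymbol u)\|_{\infty}\le C_g,\qquad \|g(\boldsymbol u)-g(\boldsymbol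 v)\|\le C_g\|\boldsymbol u-\boldsymbol v\|,\qquad \|(-\Delta)^{1/2}g(\boldsymbol u)Q^{1/2}\|_{HS}\le C_g,$$ where $-\Delta$ is the Dirichlet Laplacian. For a time step $\tau>0$ put $t_n=n\tau$ and $\delta W^n=W(t_{n+1})-W(t_n)$. Let $\boldsymbol u^0=\boldsymbol u_0$ and $p^0$ be $\mathcal F_0$-measurable, with $\boldsymbol u_0\in H^1(\mathcal O;\mathbb R^2)\cap\mathbf H$ and $p^0\in H^1(\mathcal O)$ almost surely, let $\xi^0=\eta^0=1$, and let $(\tilde{\boldsymbol u}^{n+1},\boldsymbol u^{n+1},p^{n+1},\xi^{n+1},\eta^{n+1})$, $0\le n<N$, with velocities $\tilde{\boldsymbol u}^{n+1}\in H^1_0(\mathcal O;\mathbb R^2)$, $\boldsymbol u^{n+1}\in H^1(\mathcal O;\mathbb R^2)$, pressures $p^{n+1}\in H^1(\mathcal O)$ and with $\tilde{\boldsymbol u}^{n+1},\boldsymbol u^{n+1},\nabla p^{n+1},\xi^{n+1},\eta^{n+1}$ being $\mathcal F_{t_{n+1}}$-measurable, almost surely solve the scheme $$\begin{aligned} &\tilde{\boldsymbol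 u}^{n+1}-\boldsymbol u^n=\tau\Delta\tilde{\boldsymbol u}^{n+1}-\tau\xi^{n+1}[\boldsymbol u^n\cdot\nabla]\boldsymbol u^n-\tau\nabla p^n+\eta^{n+1}g(\boldsymbol u^n)\delta W^n,\qquad \tilde{\boldsymbol u}^{n+1}|_{\partial\mathcal O}=0,\\ &\boldsymbol u^{n+1}-\tilde{\boldsymbol u}^{n+1}+\tau(\nabla p^{n+1}-\nabla p^n)=0,\qquad \nabla\cdot\boldsymbol u^{n+1}=0,\quad \boldsymbol u^{n+1}\cdot\mathbf n|_{\partial\mathcal O}=0,\\ &\xi^{n+1}-\xi^n=\tau([\boldsymbol u^n\cdot\nabla]\boldsymbol u^n,\tilde{\boldsymbol u}^{n+1}),\\ &\eta^{n+1}-\eta^n=-(g(\boldsymbol u^n)\delta W^n,\ \tilde{\boldsymbol u}^{n+1}-\boldsymbol u^n-g(\boldsymbol u^n)\delta W^n), \end{aligned}$$ where the first equation is understood in the variational sense, tested with $H^1_0(\mathcal O;\mathbb R^2)$. Then the scheme is unconditionally stable: for every $T\ge 0$ and every real $m\ge1$ there is a constant $C<\infty$ depending only on $T$, $m$, $C_g$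 and $\mathrm{Tr}(Q)$ such that, for every step size $\tau>0$ and every $N$ with $N\tau\le T$, and for all $0\le n<N$, $$\mathbf E\|\boldsymbol u^{n+1}\|^{2m}+\mathbf E\Big(\tau\sum_{j=0}^n\|\nabla\tilde{\boldsymbol u}^{j+1}\|^2\Big)^m+\mathbf E|\xi^{n+1}|^{2m}+\mathbf E|\eta^{n+1}|^{2m}+\tau^{2m}\mathbf E\|\nabla p^{n+1}\|^{2m}\le C\Big(1+\mathbf E\|\boldsymbol u_0\|^{2m}+\tau^{2m}\mathbf E\|\nabla p^0\|^{2m}\Big).$$ In particular the left-hand side is finite, with a bound that is uniform in $n$ and $\tau$, whenever $\mathbf E\|\boldsymbol u_0\|^{2m}<\infty$ and $\mathbf E\|\nabla p^0\|^{2m}<\infty$ (for instance for deterministic $\boldsymbol u_0$ and $p^0$). -/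

import Mathlib

open MeasureTheory ProbabilityTheory
open scoped NNReal ENNReal

universe u

namespace SAV

noncomputable section

/-! ## The domain and the Lebesgue spaces -/

/-- The Euclidean plane. -/
abbrev Plane : Type := EuclideanSpace ℝ (Fin 2)

/-- The open unit square (its closure `[0,1]²` differs from it by a Lebesgue null set). -/
def square : Set Plane := {x | ∀ i, x i ∈ Set.Ioo (0 : ℝ) 1}

/-- Lebesgue measure on the square. -/
abbrev leb : Measure Plane := volume.restrict square

/-- Scalar fields `L²(𝒪)`. -/
abbrev ScalL2 : Type := Lp ℝ 2 leb

/-- Vector fields `𝐋²(𝒪) = L²(𝒪; ℝ²)`. -/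
abbrev VecL2 : Type := Lp Plane 2 leb

/-- Gradients of vector fields: the pair `(∂₁v, ∂₂v)` of partial derivatives, with the Hilbert norm
`‖D‖² = ∑ᵢ ‖∂ᵢv‖²`, that is the `L²` norm of the Frobenius norm. -/
abbrev GradL2 : Type := PiLp 2 (fun _ : Fin 2 => VecL2)

/-- Essentially bounded `2 × 2` matrix fields `L^∞(𝒪; ℒ(ℝ²))`. -/
abbrev MatLinf : Type := Lp (Plane →L[ℝ] Plane) ∞ leb

/-- The `i`-th coordinate vector of the plane. -/
def coordVec (i : Fin 2) : Plane := EuclideanSpace.single i 1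

/-! ## Weak derivatives and Sobolev spaces -/

/-- Smooth functions with compact support inside the open square. -/
def IsTest {F : Type} [NormedAddCommGroup F] [NormedSpace ℝ F] (φ : Plane → F) : Prop :=
  ContDiff ℝ (⊤ : ℕ∞) φ ∧ HasCompactSupport φ ∧ tsupport φ ⊆ square

/-- `w` is the weak partial derivative `∂ᵢ v` in the square. -/
def IsWeakPartial {F : Type} [NormedAddCommGroup F] [NormedSpace ℝ F]
    (i : Fin 2) (v w : Lp F 2 leb) : Prop :=
  ∀ φ : Plane → ℝ, IsTest φ →
    ∫ x, fderiv ℝ φ x (coordVec i) • v x ∂leb = - ∫ x, φ x • w x ∂leb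

/-- `v ∈ 𝐇¹(𝒪)` with weak gradient `D = ∇v`. -/
def IsWeakGrad (v : VecL2) (D : GradL2) : Prop :=
  ∀ i, IsWeakPartial i v (D i)

/-- The `i`-th component of a vector field. -/
def component (i : Fin 2) (v : VecL2) : ScalL2 :=
  (EuclideanSpace.proj i : Plane →L[ℝ] ℝ).compLp v

/-- `p ∈ H¹(𝒪)` (scalar) with weak gradient `G = ∇p`, a vector field. -/
def IsScalarGrad (p : ScalL2) (G : VecL2) : Prop :=
  ∀ i, IsWeakPartial i p (component i G)

/-- `v ∈ 𝐇¹₀(𝒪)` with gradient `D = ∇v`: the pair `(v, ∇v)` is an `𝐇¹` limit of pairs `(φ, ∇φ)`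
with `φ` smooth and compactly supported in the open square. -/
def IsH10 (v : VecL2) (D : GradL2) : Prop :=
  (v, D) ∈ closure {z : VecL2 × GradL2 | ∃ φ : Plane → Plane, IsTest φ ∧
    (z.1 : Plane → Plane) =ᵐ[leb] φ ∧
    ∀ i, (z.2 i : Plane → Plane) =ᵐ[leb] fun x => fderiv ℝ φ x (coordVec i)}

/-- `d` is the weak divergence of `v` in the square. -/
def HasWeakDiv (v : VecL2) (d : ScalL2) : Prop :=
  ∀ φ : Plane → ℝ, IsTest φ →
    ∫ x, ∑ i, v x i * fderiv ℝ φ x (coordVec i) ∂leb = - ∫ x, φ x * d x ∂leb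

/-- The space `𝐇` of square integrable divergence-free fields. -/
def spaceH : Set VecL2 := {v | HasWeakDiv v 0}

/-- For a field `v` with weak divergence `d`: the normal trace `v · n` on the boundary vanishes,
where `⟨v · n, q⟩ = (v, ∇q) + (d, q)` for `q ∈ H¹(𝒪)`. -/
def NormalTraceVanishes (v : VecL2) (d : ScalL2) : Prop :=
  ∀ (q : ScalL2) (G : VecL2), IsScalarGrad q G → inner ℝ v G + inner ℝ d q = 0

/-- The pairing `([v · ∇]v, w) = ∫ ∑ᵢ vᵢ ∂ᵢv · w`, where `D = ∇v`. -/
def convection (v : VecL2) (D : GradL2) (w : VecL2) : ℝ :=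
  ∫ x, ∑ i, v x i * inner ℝ (D i x) (w x) ∂leb

/-! ## The noise coefficient -/

/-- The Nemytskii operator of a bounded matrix field: `(A χ)(x) = A(x) χ(x)`. -/
def nemytskii (A : MatLinf) (χ : VecL2) : VecL2 :=
  (ContinuousLinearMap.id ℝ (Plane →L[ℝ] Plane)).holder 2 A χ

theorem nemytskii_apply (A : MatLinf) (χ : VecL2) :
    (nemytskii A χ : Plane → Plane) =ᵐ[leb] fun x => A x (χ x) :=
  ContinuousLinearMap.coeFn_holder _ _ _

/-- The normalized Dirichlet eigenfunctions of `-Δ` on the square. -/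
def dirichletMode (j k : ℕ) (x : Plane) : ℝ :=
  2 * Real.sin ((j + 1) * Real.pi * x 0) * Real.sin ((k + 1) * Real.pi * x 1)

/-- The Dirichlet eigenvalues of `-Δ` on the square. -/
def dirichletEigenvalue (j k : ℕ) : ℝ :=
  Real.pi ^ 2 * ((j + 1) ^ 2 + (k + 1) ^ 2)

/-- `‖(-Δ)^{1/2} v‖²` for the Dirichlet Laplacian acting componentwise, through its spectral
decomposition; it is infinite when `v` is not in the domain of `(-Δ)^{1/2}`. -/
def sqrtLaplaceNormSq (v : VecL2) : ℝ≥0∞ :=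
  ∑' jk : ℕ × ℕ, ∑ i : Fin 2, ENNReal.ofReal
    (dirichletEigenvalue jk.1 jk.2 * (∫ x, v x i * dirichletMode jk.1 jk.2 x ∂leb) ^ 2)

/-- A symmetric nonnegative trace class operator `Q` on `𝐋²(𝒪)`, given by its eigenpairs
`(qⱼ, eⱼ)`, the `eⱼ` forming an orthonormal basis. -/
structure TraceClassCov where
  e : HilbertBasis ℕ ℝ VecL2
  q : ℕ → ℝ
  nonneg : ∀ j, 0 ≤ q j
  summable : Summable q

/-- The trace of `Q`. -/
def TraceClassCov.trace (Q : TraceClassCov) : ℝ := ∑' j, Q.q j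

/-- The assumption on `g`: uniformly bounded and Lipschitz continuous on `𝐇`, with
`‖(-Δ)^{1/2} g(v) Q^{1/2}‖_HS ≤ C_g`, where `Q^{1/2} eⱼ = √qⱼ eⱼ`. -/
structure NoiseAssumption (Q : TraceClassCov) (g : VecL2 → MatLinf) (Cg : ℝ) : Prop where
  pos : 0 < Cg
  bounded : ∀ v ∈ spaceH, ‖g v‖ ≤ Cg
  lipschitz : ∀ v ∈ spaceH, ∀ w ∈ spaceH,
    eLpNorm (fun x => g v x - g w x) 2 leb ≤ ENNReal.ofReal (Cg * ‖v - w‖)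
  hilbertSchmidt : ∀ v ∈ spaceH,
    ∑' j, sqrtLaplaceNormSq (nemytskii (g v) (Real.sqrt (Q.q j) • Q.e j)) ≤
      ENNReal.ofReal (Cg ^ 2)

/-! ## The Wiener process -/

/-- The `βⱼ` are independent standard Brownian motions relative to the filtration `ℱ`: they are
adapted, and their increments after time `s` are jointly independent of `ℱ s`. -/
structure IsBrownianFamily {Ω : Type u} [mΩ : MeasurableSpace Ω] (P : Measure Ω)
    (ℱ : Filtration ℝ≥0 mΩ) (β : ℕ → ℝ≥0 → Ω → ℝ) : Prop where
  brownian : ∀ j, IsBrownianReal (β j) P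
  indep : iIndepFun (fun j ω t => β j t ω) P
  adapted : ∀ j t, Measurable[ℱ t] (β j t)
  indep_past : ∀ s t, s ≤ t →
    Indep (MeasurableSpace.comap (fun ω j => β j t ω - β j s ω) MeasurableSpace.pi) (ℱ s) P

/-- `W` is a `Q`-Wiener process: `W(t) = ∑ⱼ √qⱼ βⱼ(t) eⱼ` almost surely, for every `t`. -/
def IsQWiener {Ω : Type u} [mΩ : MeasurableSpace Ω] (P : Measure Ω)
    (ℱ : Filtration ℝ≥0 mΩ) (Q : TraceClassCov) (W : ℝ≥0 → Ω → VecL2) : Prop :=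
  (∀ t, StronglyMeasurable[ℱ t] (W t)) ∧
  ∃ β : ℕ → ℝ≥0 → Ω → ℝ, IsBrownianFamily P ℱ β ∧
    ∀ t, ∀ᵐ ω ∂P, HasSum (fun j => (Real.sqrt (Q.q j) * β j t ω) • Q.e j) (W t ω)

/-! ## The scheme -/

/-- The unknowns of the scheme together with their gradients; index `n` is the time level.
`ũ` and its gradient are used at levels `n ≥ 1` only. -/
structure SchemeVars (Ω : Type u) where
  u : ℕ → Ω → VecL2
  gradU : ℕ → Ω → GradL2
  uTilde : ℕ → Ω → VecL2
  gradUTilde : ℕ → Ω → GradL2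
  p : ℕ → Ω → ScalL2
  gradP : ℕ → Ω → VecL2
  ξ : ℕ → Ω → ℝ
  η : ℕ → Ω → ℝ

/-- The time level `tₙ = n τ`. -/
def gridTime (τ : ℝ≥0) (n : ℕ) : ℝ≥0 := n * τ

/-- One step of the pressure-correction scheme, from level `n` to level `n + 1`, at the outcome `ω`.
The momentum equation is in its usual variational form, with test functions in `𝐇¹₀`. -/
structure SchemeStep {Ω : Type u} (g : VecL2 → MatLinf) (W : ℝ≥0 → Ω → VecL2)
    (τ : ℝ≥0) (X : SchemeVars Ω) (n : ℕ) (ω : Ω) : Prop where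
  dirichlet : IsH10 (X.uTilde (n + 1) ω) (X.gradUTilde (n + 1) ω)
  momentum : ∀ (φ : VecL2) (Dφ : GradL2), IsH10 φ Dφ →
    inner ℝ (X.uTilde (n + 1) ω - X.u n ω) φ =
      - τ * inner ℝ (X.gradUTilde (n + 1) ω) Dφ
      - τ * X.ξ (n + 1) ω * convection (X.u n ω) (X.gradU n ω) φ
      - τ * inner ℝ (X.gradP n ω) φ
      + X.η (n + 1) ω *
          inner ℝ (nemytskii (g (X.u n ω)) (W (gridTime τ (n + 1)) ω - W (gridTime τ n) ω)) φ
  projection : X.u (n + 1) ω - X.uTilde (n + 1) ω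
      + (τ : ℝ) • (X.gradP (n + 1) ω - X.gradP n ω) = 0
  divFree : HasWeakDiv (X.u (n + 1) ω) 0
  normalTrace : NormalTraceVanishes (X.u (n + 1) ω) 0
  xi_step : X.ξ (n + 1) ω - X.ξ n ω =
    τ * convection (X.u n ω) (X.gradU n ω) (X.uTilde (n + 1) ω)
  eta_step : X.η (n + 1) ω - X.η n ω =
    - inner ℝ (nemytskii (g (X.u n ω)) (W (gridTime τ (n + 1)) ω - W (gridTime τ n) ω))
        (X.uTilde (n + 1) ω - X.u n ω
          - nemytskii (g (X.u n ω)) (W (gridTime τ (n + 1)) ω - W (gridTime τ n) ω))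

/-- `X` is an adapted solution of the scheme on the levels `0, …, N` with step `τ` and initial
velocity `u₀ ∈ 𝐕`. The initial pressure `p⁰ ∈ H¹` is a free datum. -/
structure IsSchemeSolution {Ω : Type u} [mΩ : MeasurableSpace Ω] (P : Measure Ω)
    (ℱ : Filtration ℝ≥0 mΩ) (g : VecL2 → MatLinf) (W : ℝ≥0 → Ω → VecL2)
    (τ : ℝ≥0) (N : ℕ) (u₀ : Ω → VecL2) (X : SchemeVars Ω) : Prop where
  adapted_u : ∀ n ≤ N, StronglyMeasurable[ℱ (gridTime τ n)] (X.u n)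
  adapted_gradU : ∀ n ≤ N, StronglyMeasurable[ℱ (gridTime τ n)] (X.gradU n)
  adapted_uTilde : ∀ n < N, StronglyMeasurable[ℱ (gridTime τ (n + 1))] (X.uTilde (n + 1))
  adapted_gradUTilde : ∀ n < N, StronglyMeasurable[ℱ (gridTime τ (n + 1))] (X.gradUTilde (n + 1))
  adapted_gradP : ∀ n ≤ N, StronglyMeasurable[ℱ (gridTime τ n)] (X.gradP n)
  adapted_xi : ∀ n ≤ N, Measurable[ℱ (gridTime τ n)] (X.ξ n)
  adapted_eta : ∀ n ≤ N, Measurable[ℱ (gridTime τ n)] (X.η n)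
  u_mem : ∀ n ≤ N, ∀ᵐ ω ∂P, IsWeakGrad (X.u n ω) (X.gradU n ω)
  p_mem : ∀ n ≤ N, ∀ᵐ ω ∂P, IsScalarGrad (X.p n ω) (X.gradP n ω)
  init_u : ∀ᵐ ω ∂P, X.u 0 ω = u₀ ω
  init_divFree : ∀ᵐ ω ∂P, HasWeakDiv (u₀ ω) 0
  init_xi : ∀ᵐ ω ∂P, X.ξ 0 ω = 1
  init_eta : ∀ᵐ ω ∂P, X.η 0 ω = 1
  step : ∀ n < N, ∀ᵐ ω ∂P, SchemeStep g W τ X n ω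

end

end SAV

/-! The scalars `ξ` and `η` make the energy law exact up to noise. Testing the momentum equation
with `ũ` produces a convection term that the `ξ` equation turns into a difference of squares. The
projection step does the same for the pressure, because `u'` is orthogonal to `∇p'`. The `η`
equation replaces the noise tested with the implicit `ũ` by the noise tested with the known `u`. The
result is `energy_identity`. After Young's inequality (`noise_le`) the new energy `Ψ'` satisfies `Ψ'
≤ Ψ + M + 2Ψ(a² + a⁴)` with `a = Cg ‖δW‖`, `M = 2η (g(u) δW, u)` and `|M| ≤ aΨ`.

Taking the power `m ≥ 1` pathwise (`exists_rpow_step_le`) gives the linear term `m Ψ^(m-1) M` and a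
remainder of size `Ψ^m (a² + a^(2p))`. The linear term has mean zero, since `Ψ`, `η` and `u` belong
to the past of the increment. In the remainder `Ψ^m` is independent of the increment, whose moments
are `O(τ)` with constants depending on the covariance only through its trace. Thus `E Ψ'^m ≤ (1 +
κτ) E Ψ^m`, and a discrete Gronwall argument finishes the proof. The accumulated dissipation is part
of `Ψ`, so its moment needs no maximal inequality.

The mean-zero claim needs care: `g` is not assumed measurable into `L^∞`, and its Lipschitz bound is
only in `L²`. The noise is therefore expanded along the eigenbasis. Each coefficient `(g(v) eⱼ, v)`
is continuous on the closed set `𝐇`, hence measurable, and dominated convergence sums the series. -/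

namespace SAV

/-! ### Pathwise energy inequality for one step -/

/-- The Nemytskii operator of a bounded matrix field as a continuous linear map. -/
noncomputable def nemytskiiCLM (A : MatLinf) : VecL2 →L[ℝ] VecL2 :=
  (ContinuousLinearMap.id ℝ (Plane →L[ℝ] Plane)).holderL leb ∞ 2 2 A

theorem nemytskiiCLM_apply (A : MatLinf) (χ : VecL2) : nemytskiiCLM A χ = nemytskii A χ := rfl

theorem norm_nemytskii_le (A : MatLinf) (χ : VecL2) : ‖nemytskii A χ‖ ≤ ‖A‖ * ‖χ‖ := by
  refine (ContinuousLinearMap.norm_holder_apply_apply_le _ A χ).trans ?_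
  have h : ‖ContinuousLinearMap.id ℝ (Plane →L[ℝ] Plane)‖ ≤ 1 := ContinuousLinearMap.norm_id_le
  rw [mul_assoc]
  exact mul_le_of_le_one_left (by positivity) h

/-- The energy identity of one step of the pressure-correction scheme in a Hilbert space, where `Z`
is the noise increment and `c` the value of the convection term at `ũ`. -/
theorem energy_identity {E F : Type*} [NormedAddCommGroup E] [InnerProductSpace ℝ E]
    [NormedAddCommGroup F] [InnerProductSpace ℝ F]
    (u v u' G G' Z : E) (D : F) (ξ ξ' η η' τ c : ℝ)
    (hmom : inner ℝ (v - u) v = - τ * inner ℝ D D - τ * ξ' * c - τ * inner ℝ G v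
      + η' * inner ℝ Z v)
    (hproj : u' - v + τ • (G' - G) = 0)
    (hG' : inner ℝ u' G' = (0 : ℝ))
    (hξ : ξ' - ξ = τ * c) (hη : η' - η = - inner ℝ Z (v - u - Z)) :
    ‖u'‖ ^ 2 + τ ^ 2 * ‖G'‖ ^ 2 + ξ' ^ 2 + η' ^ 2 + ‖v - u‖ ^ 2 + (ξ' - ξ) ^ 2 + (η' - η) ^ 2
        + 2 * τ * ‖D‖ ^ 2
      = ‖u‖ ^ 2 + τ ^ 2 * ‖G‖ ^ 2 + ξ ^ 2 + η ^ 2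
        + 2 * η' * inner ℝ Z u + 2 * η' * ‖Z‖ ^ 2 := by
  -- Squaring this form of the projection step leaves no cross term on the left, by `hG'`; the one
  -- on the right cancels the pressure term of the momentum equation.
  have h1 : u' + τ • G' = v + τ • G := by
    rw [← sub_eq_zero, ← hproj, smul_sub]; abel
  have h2 : ‖u'‖ ^ 2 + τ ^ 2 * ‖G'‖ ^ 2 = ‖v‖ ^ 2 + 2 * τ * inner ℝ G v + τ ^ 2 * ‖G‖ ^ 2 := by
    have h := congrArg (fun x => ‖x‖ ^ 2) h1
    simp only [norm_add_sq_real, inner_smul_right, norm_smul, mul_pow, Real.norm_eq_abs, sq_abs,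
      hG'] at h
    rw [real_inner_comm v G]
    linarith
  have h3 := norm_sub_sq_real v u
  simp only [inner_sub_left, inner_sub_right, real_inner_self_eq_norm_sq] at hmom hη
  rw [real_inner_comm v u] at hmom
  linear_combination h2 + h3 + 2 * hmom + 2 * ξ' * hξ + 2 * η' * hη

/-- Here `d` is the increment of `η`, `i = (Z, u)` and `s = ‖Z‖²`. The two products with `d` are
split by Young's inequality, each using half of the available `d²`. Only the old `η` then multiplies
`i`, so that term stays a martingale increment. -/
theorem noise_le (η d i s A U : ℝ) (hs : 0 ≤ s) (hi : i ^ 2 ≤ s * U) (hA : s ≤ A) (hU : 0 ≤ U) :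
    2 * (η + d) * i + 2 * (η + d) * s - d ^ 2
      ≤ 2 * η * i + 2 * (1 + U + η ^ 2) * (A + A ^ 2) := by
  have e1 : 2 * d * i ≤ d ^ 2 / 2 + 2 * i ^ 2 := by nlinarith only [sq_nonneg (d - 2 * i)]
  have e2 : 2 * d * s ≤ d ^ 2 / 2 + 2 * s ^ 2 := by nlinarith only [sq_nonneg (d - 2 * s)]
  have e3 : 2 * η * s ≤ (1 + η ^ 2) * s := by nlinarith only [mul_nonneg hs (sq_nonneg (1 - η))]
  have e4 : (1 + η ^ 2 + 2 * U) * s ≤ 2 * (1 + U + η ^ 2) * A := by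
    apply mul_le_mul _ hA hs (by positivity)
    nlinarith only [sq_nonneg η]
  have e5 : 2 * s ^ 2 ≤ 2 * (1 + U + η ^ 2) * A ^ 2 := by
    apply mul_le_mul _ (pow_le_pow_left₀ hs hA 2) (by positivity) (by positivity)
    nlinarith only [sq_nonneg η, hU]
  linarith

/-- The energy inequality in which the noise enters through the martingale increment
`2 η (Z, u)` and a remainder. -/
theorem energy_le {E F : Type*} [NormedAddCommGroup E] [InnerProductSpace ℝ E]
    [NormedAddCommGroup F] [InnerProductSpace ℝ F]
    (u v u' G G' Z : E) (D : F) (ξ ξ' η η' τ c a : ℝ) (hZ : ‖Z‖ ≤ a)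
    (hmom : inner ℝ (v - u) v = - τ * inner ℝ D D - τ * ξ' * c - τ * inner ℝ G v
      + η' * inner ℝ Z v)
    (hproj : u' - v + τ • (G' - G) = 0)
    (hG' : inner ℝ u' G' = (0 : ℝ))
    (hξ : ξ' - ξ = τ * c) (hη : η' - η = - inner ℝ Z (v - u - Z)) :
    ‖u'‖ ^ 2 + τ ^ 2 * ‖G'‖ ^ 2 + ξ' ^ 2 + η' ^ 2 + 2 * τ * ‖D‖ ^ 2
      ≤ ‖u‖ ^ 2 + τ ^ 2 * ‖G‖ ^ 2 + ξ ^ 2 + η ^ 2 + 2 * η * inner ℝ Z u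
        + 2 * (1 + ‖u‖ ^ 2 + η ^ 2) * (a ^ 2 + a ^ 4) := by
  have h := energy_identity u v u' G G' Z D ξ ξ' η η' τ c hmom hproj hG' hξ hη
  have hip : (inner ℝ Z u) ^ 2 ≤ ‖Z‖ ^ 2 * ‖u‖ ^ 2 := by
    rw [← mul_pow, ← sq_abs]
    exact pow_le_pow_left₀ (abs_nonneg _) (abs_real_inner_le_norm Z u) 2
  have hZ2 : ‖Z‖ ^ 2 ≤ a ^ 2 := pow_le_pow_left₀ (norm_nonneg Z) hZ 2
  have h4 := noise_le η (η' - η) _ _ _ _ (sq_nonneg ‖Z‖) hip hZ2 (sq_nonneg ‖u‖)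
  rw [add_sub_cancel] at h4
  have h5 : a ^ 4 = (a ^ 2) ^ 2 := by ring
  rw [h5]
  linarith [sq_nonneg ‖v - u‖, sq_nonneg (ξ' - ξ)]

theorem SchemeStep.energy_le {Ω : Type u} {g : VecL2 → MatLinf} {W : ℝ≥0 → Ω → VecL2}
    {τ : ℝ≥0} {X : SchemeVars Ω} {n : ℕ} {ω : Ω} (h : SchemeStep g W τ X n ω)
    (hp : IsScalarGrad (X.p (n + 1) ω) (X.gradP (n + 1) ω)) {Cg : ℝ} (hg : ‖g (X.u n ω)‖ ≤ Cg) :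
    ‖X.u (n + 1) ω‖ ^ 2 + (τ : ℝ) ^ 2 * ‖X.gradP (n + 1) ω‖ ^ 2 + X.ξ (n + 1) ω ^ 2
        + X.η (n + 1) ω ^ 2 + 2 * τ * ‖X.gradUTilde (n + 1) ω‖ ^ 2
      ≤ ‖X.u n ω‖ ^ 2 + (τ : ℝ) ^ 2 * ‖X.gradP n ω‖ ^ 2 + X.ξ n ω ^ 2 + X.η n ω ^ 2
        + 2 * X.η n ω * inner ℝ (nemytskii (g (X.u n ω))
            (W (gridTime τ (n + 1)) ω - W (gridTime τ n) ω)) (X.u n ω)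
        + 2 * (1 + ‖X.u n ω‖ ^ 2 + X.η n ω ^ 2) *
          ((Cg * ‖W (gridTime τ (n + 1)) ω - W (gridTime τ n) ω‖) ^ 2
            + (Cg * ‖W (gridTime τ (n + 1)) ω - W (gridTime τ n) ω‖) ^ 4) := by
  have hn := h.normalTrace _ _ hp
  rw [inner_zero_left, add_zero] at hn
  refine SAV.energy_le _ _ _ _ _ _ _ _ _ _ _ _ _ _ ?_
    (h.momentum _ _ h.dirichlet) h.projection hn h.xi_step h.eta_step
  exact (norm_nemytskii_le _ _).trans (by gcongr)

/-! ### Continuity and measurability of the noise coefficient on `𝐇` -/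

/-- Weak solenoidality says that the continuous functionals `v ↦ (v, ∇φ)` vanish, one for each test
function. Closedness makes extension by zero from `𝐇` preserve Borel measurability. -/
theorem isClosed_spaceH : IsClosed spaceH := by
  have : spaceH = ⋂ (φ : Plane → ℝ) (_ : IsTest φ),
      {v : VecL2 | ∫ x, ∑ i, v x i * fderiv ℝ φ x (coordVec i) ∂leb = 0} := by
    ext v
    simp only [spaceH, HasWeakDiv, Set.mem_ofPred_eq, Set.mem_iInter]
    refine forall₂_congr fun φ _ => ?_
    have : ∫ x, φ x * (0 : ScalL2) x ∂leb = 0 := by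
      rw [← integral_zero Plane ℝ (μ := leb)]
      refine integral_congr_ae ?_
      filter_upwards [Lp.coeFn_zero ℝ 2 leb] with x hx
      rw [hx]; simp
    rw [this, neg_zero]
  rw [this]
  refine isClosed_iInter fun φ => isClosed_iInter fun hφ => ?_
  obtain ⟨h1, h2, -⟩ := hφ
  have hc : Continuous (fderiv ℝ φ) := h1.continuous_fderiv (by simp)
  have hs : HasCompactSupport (fderiv ℝ φ) := h2.fderiv ℝ
  let f : Plane → Plane := fun x => WithLp.toLp 2 fun i => fderiv ℝ φ x (coordVec i)
  have hf : Continuous f := by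
    refine (PiLp.continuous_toLp 2 _).comp (continuous_pi fun i => ?_)
    exact hc.clm_apply continuous_const
  have hfs : HasCompactSupport f := by
    refine hs.mono' ?_
    intro x hx
    by_contra hx'
    have : fderiv ℝ φ x = 0 := image_eq_zero_of_notMem_tsupport hx'
    apply hx
    simp only [f, this]
    ext i; simp
  have hm : MemLp f 2 leb := (hf.memLp_of_hasCompactSupport hfs (μ := volume)).restrict _
  have key : ∀ v : VecL2, ∫ x, ∑ i, v x i * fderiv ℝ φ x (coordVec i) ∂leb
      = inner ℝ v (hm.toLp f) := by
    intro v
    rw [L2.inner_def]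
    refine integral_congr_ae ?_
    filter_upwards [hm.coeFn_toLp] with x hx
    rw [hx, PiLp.inner_apply]
    refine Finset.sum_congr rfl fun i _ => ?_
    simp [f, mul_comm]
  simp_rw [key]
  exact isClosed_eq (by fun_prop) continuous_const

theorem eLpNorm_nemytskii_sub_le (A B : MatLinf) (χ : VecL2) (M : ℝ≥0)
    (hM : ∀ᵐ x ∂leb, ‖χ x‖ ≤ M) :
    ‖nemytskii A χ - nemytskii B χ‖ₑ ≤ M * eLpNorm (fun x => A x - B x) 2 leb := by
  rw [Lp.enorm_def]
  have : eLpNorm (nemytskii A χ - nemytskii B χ : VecL2) 2 leb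
      ≤ ENNReal.ofReal M * eLpNorm (fun x => A x - B x) 2 leb := by
    refine eLpNorm_le_mul_eLpNorm_of_ae_le_mul ?_ _
    filter_upwards [hM, Lp.coeFn_sub (nemytskii A χ) (nemytskii B χ), nemytskii_apply A χ,
      nemytskii_apply B χ] with x h1 h2 h3 h4
    rw [h2, Pi.sub_apply, h3, h4, ← sub_apply, mul_comm]
    exact ((A x - B x).le_opNorm _).trans (by gcongr)
  simpa using this

/-- The Lipschitz bound is in `L²` only, so it controls `g(v) χ` in `L²` just for bounded `χ`. A
general `χ` is approximated by simple functions, and the uniform `L^∞` bound on `g` controls the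
error independently of `v`. -/
theorem NoiseAssumption.continuousOn_nemytskii {Q : TraceClassCov} {g : VecL2 → MatLinf} {Cg : ℝ}
    (hg : NoiseAssumption Q g Cg) (χ : VecL2) :
    ContinuousOn (fun v => nemytskii (g v) χ) spaceH := by
  have hCg := hg.pos
  rw [Metric.continuousOn_iff]
  intro v hv ε hε
  obtain ⟨s, hs⟩ : ∃ s : Lp.simpleFunc Plane 2 leb, ‖χ - s‖ < ε / (4 * Cg) := by
    obtain ⟨s, hs⟩ := (Lp.simpleFunc.denseRange (E := Plane) (p := 2) (μ := leb)
      (by simp)).exists_dist_lt χ (ε := ε / (4 * Cg)) (by positivity)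
    exact ⟨s, by rwa [dist_eq_norm] at hs⟩
  obtain ⟨M, hM⟩ : ∃ M : ℝ≥0, ∀ᵐ x ∂leb, ‖(s : VecL2) x‖ ≤ M := by
    obtain ⟨M, hM⟩ := (Lp.simpleFunc.toSimpleFunc s).exists_forall_norm_le
    refine ⟨M.toNNReal, ?_⟩
    filter_upwards [Lp.simpleFunc.toSimpleFunc_eq_toFun s] with x hx
    have hx' : (s : VecL2) x = (Lp.simpleFunc.toSimpleFunc s) x := hx.symm
    rw [hx']
    exact (hM x).trans (Real.le_coe_toNNReal M)
  -- The budget is `ε/2` for the bounded part and `ε/4` for each of the two approximation errors; `M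
  -- + 1` avoids division by zero.
  refine ⟨ε / (2 * (M + 1) * Cg), by positivity, fun w hw hwv => ?_⟩
  rw [dist_eq_norm] at hwv ⊢
  have h1 : ‖nemytskii (g w) s - nemytskii (g v) s‖ ≤ M * (Cg * ‖w - v‖) := by
    have h := (eLpNorm_nemytskii_sub_le (g w) (g v) s M hM).trans
      (mul_le_mul_right (hg.lipschitz w hw v hv) _)
    rw [← ofReal_norm, ← ENNReal.ofReal_coe_nnreal, ← ENNReal.ofReal_mul (by positivity),
      ENNReal.ofReal_le_ofReal_iff (by positivity)] at h
    exact h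
  have h2 : ∀ z ∈ spaceH, ‖nemytskii (g z) (χ - s)‖ ≤ ε / 4 := by
    intro z hz
    calc ‖nemytskii (g z) (χ - s)‖ ≤ Cg * (ε / (4 * Cg)) :=
          (norm_nemytskii_le _ _).trans (mul_le_mul (hg.bounded z hz) hs.le (by positivity) hCg.le)
      _ = ε / 4 := by field_simp
  have h3 : nemytskii (g w) χ - nemytskii (g v) χ
      = (nemytskii (g w) s - nemytskii (g v) s) + nemytskii (g w) (χ - s)
        - nemytskii (g v) (χ - s) := by
    simp only [← nemytskiiCLM_apply, map_sub]; abel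
  have h4 : M * (Cg * ‖w - v‖) < ε / 2 := by
    calc M * (Cg * ‖w - v‖) ≤ (M + 1) * Cg * ‖w - v‖ := by
          rw [mul_assoc]; gcongr; simp
      _ < (M + 1) * Cg * (ε / (2 * (M + 1) * Cg)) := by gcongr
      _ = ε / 2 := by field_simp
  rw [h3]
  have h5 := norm_sub_le ((nemytskii (g w) s - nemytskii (g v) s) + nemytskii (g w) (χ - s))
    (nemytskii (g v) (χ - s))
  have h6 := norm_add_le (nemytskii (g w) s - nemytskii (g v) s) (nemytskii (g w) (χ - s))
  linarith [h2 w hw, h2 v hv]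

/-- A globally defined measurable version of `v ↦ (g(v) χ, v)`, extended by zero from `𝐇`. -/
theorem NoiseAssumption.measurable_indicator_inner {Q : TraceClassCov} {g : VecL2 → MatLinf}
    {Cg : ℝ} (hg : NoiseAssumption Q g Cg) (χ : VecL2) [MeasurableSpace VecL2] [BorelSpace VecL2] :
    Measurable (spaceH.indicator fun v => (inner ℝ (nemytskii (g v) χ) v : ℝ)) := by
  classical
  have hc : ContinuousOn (fun v => (inner ℝ (nemytskii (g v) χ) v : ℝ)) spaceH :=
    (hg.continuousOn_nemytskii χ).inner continuousOn_id
  have h := hc.measurable_piecewise (g := fun _ => 0) continuousOn_const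
    isClosed_spaceH.measurableSet
  rw [← Set.piecewise_eq_indicator]
  exact h


/-! ### The power `m` of a multiplicative recursion -/

/-- This is a quadratic remainder estimate that avoids the second derivative, and so has no
singularity as `y → 0`. Comparison with the integer power `y ^ j` reduces it to a geometric
induction for `y ≥ 1` and to Bernoulli's inequality for `y ≤ 1`. -/
theorem rpow_sub_one_mul_le {s y : ℝ} {j : ℕ} (hj : s ≤ j) (hy : 0 < y) :
    (y ^ s - 1) * (y - 1) ≤ j * (y - 1) ^ 2 * (1 + |y - 1|) ^ j := by
  rcases le_total 1 y with h | h
  · have h1 : y ^ s ≤ y ^ j := by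
      rw [← Real.rpow_natCast]; exact Real.rpow_le_rpow_of_exponent_le h hj
    have h2 : ∀ k : ℕ, y ^ k - 1 ≤ k * (y - 1) * y ^ k := by
      intro k
      induction k with
      | zero => simp
      | succ k ih =>
        have h3 : 1 ≤ y ^ (k + 1) := one_le_pow₀ h
        push_cast
        calc y ^ (k + 1) - 1 = y * (y ^ k - 1) + (y - 1) * 1 := by ring
          _ ≤ y * (k * (y - 1) * y ^ k) + (y - 1) * y ^ (k + 1) := by
            gcongr
          _ = _ := by ring
    rw [abs_of_nonneg (by linarith), add_sub_cancel]
    calc (y ^ s - 1) * (y - 1) ≤ (j * (y - 1) * y ^ j) * (y - 1) := by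
          apply mul_le_mul_of_nonneg_right _ (by linarith)
          linarith [h2 j]
      _ = _ := by ring
  · have h1 : y ^ j ≤ y ^ s := by
      rw [← Real.rpow_natCast]; exact Real.rpow_le_rpow_of_exponent_ge hy h hj
    have h2 := one_add_mul_le_pow (a := y - 1) (by linarith) j
    rw [add_sub_cancel] at h2
    have h3 : (1 : ℝ) ≤ (1 + |y - 1|) ^ j := one_le_pow₀ (by simp)
    calc (y ^ s - 1) * (y - 1) = (1 - y ^ s) * (1 - y) := by ring
      _ ≤ (j * (1 - y)) * (1 - y) := by
          apply mul_le_mul_of_nonneg_right _ (by linarith)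
          linarith
      _ = j * (y - 1) ^ 2 * 1 := by ring
      _ ≤ _ := by gcongr

/-- Convexity puts the tangent at `y` below the graph at `1`; this is Bernoulli's inequality for
`y⁻¹`. The slope `y ^ (m - 1)` is then replaced by `1`, at the cost bounded in
`rpow_sub_one_mul_le`. -/
theorem rpow_le_taylor {m y : ℝ} {j : ℕ} (hm : 1 ≤ m) (hj : m ≤ j) (hy : 0 < y) :
    y ^ m ≤ 1 + m * (y - 1) + m * (j * (y - 1) ^ 2 * (1 + |y - 1|) ^ j) := by
  have h1 : y ^ m - 1 ≤ m * y ^ (m - 1) * (y - 1) := by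
    have h := one_add_mul_self_le_rpow_one_add (s := y⁻¹ - 1)
      (by have := inv_pos.2 hy; linarith) hm
    rw [add_sub_cancel, Real.inv_rpow hy.le] at h
    have hym : 0 < y ^ m := Real.rpow_pos_of_pos hy m
    have h' := mul_le_mul_of_nonneg_left h hym.le
    rw [mul_inv_cancel₀ hym.ne'] at h'
    have h2 : y ^ (m - 1) = y ^ m * y⁻¹ := by rw [Real.rpow_sub_one hy.ne', div_eq_mul_inv]
    rw [h2]
    have h3 : m * (y ^ m * y⁻¹) * (y - 1) = m * y ^ m * (1 - y⁻¹) := by field_simp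
    rw [h3]
    linarith
  have h2 := rpow_sub_one_mul_le (s := m - 1) (j := j) (by linarith) hy
  have h3 := mul_le_mul_of_nonneg_left h2 (by linarith : 0 ≤ m)
  linarith

/-- The factor `x ^ 2` supplies `a ^ 2`, which makes the remainder first order in the time step.
Both exponents of `a` are even, so the bound depends on the increment only through its squared norm.
-/
theorem sq_mul_pow_le {a x : ℝ} (j : ℕ) (ha : 0 ≤ a) (hx : |x| ≤ a + 2 * (a ^ 2 + a ^ 4)) :
    x ^ 2 * (1 + |x|) ^ j ≤ 25 * 5 ^ j * 2 ^ (4 * j + 6) * (a ^ 2 + a ^ (2 * (2 * j + 4))) := by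
  have h1 : a + 2 * (a ^ 2 + a ^ 4) ≤ 5 * a * (1 + a) ^ 3 := by
    nlinarith only [ha, pow_nonneg ha 2, pow_nonneg ha 3, pow_nonneg ha 4]
  have h2 : 1 + (a + 2 * (a ^ 2 + a ^ 4)) ≤ 5 * (1 + a) ^ 4 := by
    nlinarith only [ha, pow_nonneg ha 2, pow_nonneg ha 3, pow_nonneg ha 4]
  have h3 : a ^ 2 * (1 + a) ^ (4 * j + 6)
      ≤ 2 ^ (4 * j + 6) * (a ^ 2 + a ^ (2 * (2 * j + 4))) := by
    have h4 := add_pow_le (a := 1) (b := a) zero_le_one ha (4 * j + 6)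
    have h5 : (2 : ℝ) ^ (4 * j + 6 - 1) ≤ 2 ^ (4 * j + 6) :=
      pow_le_pow_right₀ one_le_two (Nat.sub_le _ _)
    calc a ^ 2 * (1 + a) ^ (4 * j + 6)
        ≤ a ^ 2 * (2 ^ (4 * j + 6) * (1 ^ (4 * j + 6) + a ^ (4 * j + 6))) := by
          gcongr
          exact h4.trans (by gcongr)
      _ = _ := by ring
  calc x ^ 2 * (1 + |x|) ^ j = |x| ^ 2 * (1 + |x|) ^ j := by rw [sq_abs]
    _ ≤ (5 * a * (1 + a) ^ 3) ^ 2 * (5 * (1 + a) ^ 4) ^ j := by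
        gcongr
        · exact hx.trans h1
        · linarith
    _ = 25 * 5 ^ j * (a ^ 2 * (1 + a) ^ (4 * j + 6)) := by
        rw [mul_pow 5 _ j, ← pow_mul, pow_add]; ring
    _ ≤ 25 * 5 ^ j * (2 ^ (4 * j + 6) * (a ^ 2 + a ^ (2 * (2 * j + 4)))) := by gcongr
    _ = _ := by ring

/-- One step of a multiplicative recursion, raised to the power `m`. -/
theorem exists_rpow_step_le {m : ℝ} (hm : 1 ≤ m) : ∃ K : ℝ, 0 ≤ K ∧ ∃ p : ℕ, 1 ≤ p ∧
    ∀ Ψ Ψ' M a : ℝ, 0 < Ψ → 0 < Ψ' → 0 ≤ a → |M| ≤ a * Ψ →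
      Ψ' ≤ Ψ + M + 2 * Ψ * (a ^ 2 + a ^ 4) →
      Ψ' ^ m ≤ Ψ ^ m + m * (Ψ ^ (m - 1) * M) + K * (Ψ ^ m * (a ^ 2 + a ^ (2 * p))) := by
  obtain ⟨j, hj⟩ := exists_nat_ge m
  have hm0 : 0 ≤ m := by linarith
  -- The first summand pays for the drift `2 m (a² + a⁴)`, as `a²` and `a⁴` are each at most `a² +
  -- a^(2p)`; the second is the Taylor remainder.
  refine ⟨m * 4 + m * (j * (25 * 5 ^ j * 2 ^ (4 * j + 6))), by positivity, 2 * j + 4, by omega,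
    fun Ψ Ψ' M a hΨ hΨ' ha hM h => ?_⟩
  set x : ℝ := M / Ψ + 2 * (a ^ 2 + a ^ 4) with hx
  have hMΨ : |M / Ψ| ≤ a := by
    rw [abs_div, abs_of_pos hΨ]; exact (div_le_iff₀ hΨ).2 hM
  have hxa : |x| ≤ a + 2 * (a ^ 2 + a ^ 4) := by
    refine (abs_add_le _ _).trans ?_
    rw [abs_of_nonneg (by positivity : 0 ≤ 2 * (a ^ 2 + a ^ 4))]
    linarith
  have h1 : Ψ' ≤ Ψ * (1 + x) := by
    have : Ψ * (1 + x) = Ψ + M + 2 * Ψ * (a ^ 2 + a ^ 4) := by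
      rw [hx]; field_simp; ring
    rwa [this]
  -- The noise may be large and negative; positivity of the base comes from `Ψ'`, not from a bound
  -- on `x`.
  have hy : 0 < 1 + x := by
    have := hΨ'.trans_le h1
    exact (mul_pos_iff_of_pos_left hΨ).1 this
  have h2 : Ψ' ^ m ≤ Ψ ^ m * (1 + x) ^ m := by
    rw [← Real.mul_rpow hΨ.le hy.le]
    exact Real.rpow_le_rpow hΨ'.le h1 hm0
  have h3 := rpow_le_taylor hm hj hy
  rw [add_sub_cancel_left] at h3
  have h4 := sq_mul_pow_le j ha hxa
  have h5 : a ^ 4 ≤ a ^ 2 + a ^ (2 * (2 * j + 4)) := by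
    rcases le_total a 1 with h | h
    · have := pow_le_pow_of_le_one ha h (show 2 ≤ 4 by norm_num)
      have := pow_nonneg ha (2 * (2 * j + 4))
      linarith
    · have := pow_le_pow_right₀ h (show 4 ≤ 2 * (2 * j + 4) by omega)
      have := pow_nonneg ha 2
      linarith
  have h6 : a ^ 2 ≤ a ^ 2 + a ^ (2 * (2 * j + 4)) := by
    have := pow_nonneg ha (2 * (2 * j + 4)); linarith
  have hΨm : 0 < Ψ ^ m := Real.rpow_pos_of_pos hΨ m
  set b : ℝ := a ^ 2 + a ^ (2 * (2 * j + 4))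
  have h7 : (1 + x) ^ m ≤ 1 + m * (M / Ψ) +
      (m * 4 + m * (j * (25 * 5 ^ j * 2 ^ (4 * j + 6)))) * b := by
    have h8 : m * (j * x ^ 2 * (1 + |x|) ^ j) ≤ m * (j * (25 * 5 ^ j * 2 ^ (4 * j + 6) * b)) := by
      rw [mul_assoc (j : ℝ)]
      gcongr
    have h9 : m * x ≤ m * (M / Ψ) + m * (4 * b) := by
      rw [← mul_add]
      gcongr
      rw [hx]
      linarith
    linarith
  have h8 : Ψ ^ (m - 1) * M = Ψ ^ m * (M / Ψ) := by
    rw [Real.rpow_sub_one hΨ.ne']; ring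
  rw [h8]
  refine (h2.trans (mul_le_mul_of_nonneg_left h7 hΨm.le)).trans (le_of_eq ?_)
  ring


/-! ### Orthonormal series and Gaussian moments -/

theorem norm_sq_sum_of_orthonormal {E ι : Type*} [NormedAddCommGroup E] [InnerProductSpace ℝ E]
    {e : ι → E} (he : Orthonormal ℝ e) (c : ι → ℝ) (s : Finset ι) :
    ‖∑ j ∈ s, c j • e j‖ ^ 2 = ∑ j ∈ s, c j ^ 2 := by
  rw [← real_inner_self_eq_norm_sq, he.inner_sum]
  exact Finset.sum_congr rfl fun j _ => by simp [sq]

theorem hasSum_sq_of_orthonormal {E ι : Type*} [NormedAddCommGroup E] [InnerProductSpace ℝ E]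
    {e : ι → E} (he : Orthonormal ℝ e) {c : ι → ℝ} {w : E} (h : HasSum (fun j => c j • e j) w) :
    HasSum (fun j => c j ^ 2) (‖w‖ ^ 2) := by
  have h1 := (h.norm).pow 2
  simp_rw [norm_sq_sum_of_orthonormal he] at h1
  exact h1

theorem norm_sum_le_of_orthonormal {E ι : Type*} [NormedAddCommGroup E] [InnerProductSpace ℝ E]
    {e : ι → E} (he : Orthonormal ℝ e) {c : ι → ℝ} {w : E} (h : HasSum (fun j => c j • e j) w)
    (s : Finset ι) : ‖∑ j ∈ s, c j • e j‖ ≤ ‖w‖ := by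
  rw [← sq_le_sq₀ (norm_nonneg _) (norm_nonneg _), norm_sq_sum_of_orthonormal he]
  exact sum_le_hasSum s (fun j _ => sq_nonneg _) (hasSum_sq_of_orthonormal he h)

/-- Jensen's inequality for the weights `w`, from weighted Hölder on finite sums and a limit. With
`w = q` it brings in the covariance through its trace alone. -/
theorem tsum_mul_pow_le (w f : ℕ → ℝ≥0∞) {p : ℕ} (hp : 1 ≤ p) :
    (∑' j, w j * f j) ^ p ≤ (∑' j, w j) ^ (p - 1) * ∑' j, w j * f j ^ p := by
  have hp0 : (p : ℝ) ≠ 0 := by positivity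
  have hfin : ∀ s : Finset ℕ, (∑ j ∈ s, w j * f j) ^ p
      ≤ (∑' j, w j) ^ (p - 1) * ∑' j, w j * f j ^ p := by
    intro s
    have h := ENNReal.inner_le_weight_mul_Lp_of_nonneg s (p := p) (by exact_mod_cast hp) w f
    have h' := ENNReal.rpow_le_rpow h (Nat.cast_nonneg p)
    rw [ENNReal.mul_rpow_of_nonneg _ _ (Nat.cast_nonneg p), ← ENNReal.rpow_mul,
      ← ENNReal.rpow_mul, inv_mul_cancel₀ hp0, ENNReal.rpow_one, ENNReal.rpow_natCast] at h'
    have h2 : (1 - (p : ℝ)⁻¹) * p = ((p - 1 : ℕ) : ℝ) := by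
      rw [Nat.cast_sub hp, Nat.cast_one]; field_simp
    rw [h2, ENNReal.rpow_natCast] at h'
    simp_rw [ENNReal.rpow_natCast] at h'
    refine h'.trans ?_
    gcongr
    · exact ENNReal.sum_le_tsum s
    · exact ENNReal.sum_le_tsum s
  exact le_of_tendsto' (((ENNReal.continuous_pow p).tendsto _).comp
    ENNReal.summable.hasSum) hfin

/-- The moment of order `2p` of the standard Gaussian. -/
noncomputable def gaussianMoment (p : ℕ) : ℝ≥0∞ :=
  ∫⁻ x, ENNReal.ofReal (x ^ 2) ^ p ∂(gaussianReal 0 1)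

theorem gaussianMoment_lt_top (p : ℕ) : gaussianMoment p < ∞ := by
  have h := (memLp_id_gaussianReal (μ := 0) (v := 1) ((2 * p : ℕ) : ℝ≥0)).eLpNorm_lt_top
  rcases Nat.eq_zero_or_pos p with rfl | hp
  · simp [gaussianMoment]
  have h2 := lintegral_rpow_enorm_lt_top_of_eLpNorm_lt_top (p := ((2 * p : ℕ) : ℝ≥0))
    (by norm_cast; omega) ENNReal.coe_ne_top h
  refine lt_of_le_of_lt (lintegral_mono fun x => ?_) h2
  simp only [id, ENNReal.coe_toReal, NNReal.coe_natCast, ENNReal.rpow_natCast]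
  rw [pow_mul, ← sq_abs, ENNReal.ofReal_pow (abs_nonneg x), ← Real.norm_eq_abs, ofReal_norm]

theorem lintegral_gaussianReal_pow (v : ℝ≥0) (p : ℕ) :
    ∫⁻ x, ENNReal.ofReal (x ^ 2) ^ p ∂(gaussianReal 0 v) = v ^ p * gaussianMoment p := by
  have h := gaussianReal_map_const_mul (μ := 0) (v := 1) (Real.sqrt v)
  have hv : NNReal.mk (Real.sqrt v ^ 2) (sq_nonneg _) * 1 = v := by
    ext; simp
  rw [hv, mul_zero] at h
  rw [← h, lintegral_map (by fun_prop) (by fun_prop), gaussianMoment,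
    ← lintegral_const_mul _ (by fun_prop)]
  refine lintegral_congr fun x => ?_
  rw [mul_pow, Real.sq_sqrt v.coe_nonneg, ENNReal.ofReal_mul v.coe_nonneg, mul_pow, ENNReal.ofReal_coe_nnreal]

/-! ### Increments of the Brownian family -/

/-- The σ-algebra generated by the increments from `s` to `t`. -/
@[reducible]
def incrementAlgebra {Ω : Type u} (β : ℕ → ℝ≥0 → Ω → ℝ) (s t : ℝ≥0) : MeasurableSpace Ω :=
  MeasurableSpace.comap (fun ω j => β j t ω - β j s ω) MeasurableSpace.pi

theorem measurable_increment {Ω : Type u} (β : ℕ → ℝ≥0 → Ω → ℝ) (s t : ℝ≥0) (j : ℕ) :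
    Measurable[incrementAlgebra β s t] fun ω => β j t ω - β j s ω :=
  (measurable_pi_apply j).comp (comap_measurable fun ω j => β j t ω - β j s ω)

/-- The squared norm of the increment of the Wiener process, as a function of the increments of
the Brownian motions. -/
noncomputable def incrementNormSq {Ω : Type u} (Q : TraceClassCov) (β : ℕ → ℝ≥0 → Ω → ℝ) (s t : ℝ≥0) (ω : Ω) :
    ℝ≥0∞ :=
  ∑' j, ENNReal.ofReal (Q.q j) * ENNReal.ofReal ((β j t ω - β j s ω) ^ 2)

theorem measurable_incrementNormSq {Ω : Type u} (Q : TraceClassCov) (β : ℕ → ℝ≥0 → Ω → ℝ) (s t : ℝ≥0) :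
    Measurable[incrementAlgebra β s t] (incrementNormSq Q β s t) := by
  have h : Measurable fun x : ℕ → ℝ =>
      ∑' j, ENNReal.ofReal (Q.q j) * ENNReal.ofReal (x j ^ 2) :=
    Measurable.tsum fun j => by fun_prop
  exact h.comp (comap_measurable fun ω j => β j t ω - β j s ω)

section Increments

variable {Ω : Type u} [mΩ : MeasurableSpace Ω] {P : Measure Ω} {ℱ : Filtration ℝ≥0 mΩ}
  {β : ℕ → ℝ≥0 → Ω → ℝ} {s t : ℝ≥0}

theorem IsBrownianFamily.increment_le (hβ : IsBrownianFamily P ℱ β) (s t : ℝ≥0) :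
    incrementAlgebra β s t ≤ mΩ := by
  refine Measurable.comap_le (measurable_pi_lambda _ fun j => ?_)
  exact ((hβ.adapted j t).mono (ℱ.le t) le_rfl).sub ((hβ.adapted j s).mono (ℱ.le s) le_rfl)

theorem IsBrownianFamily.hasLaw_increment (hβ : IsBrownianFamily P ℱ β) (hst : s ≤ t) (j : ℕ) :
    HasLaw (fun ω => β j t ω - β j s ω) (gaussianReal 0 (t - s)) P := by
  have h := (hβ.brownian j).toIsPreBrownianReal.hasLaw_sub t s
  have h2 : nndist t.1 s.1 = t - s := by
    apply NNReal.coe_injective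
    rw [NNReal.coe_sub hst]
    refine (Real.dist_eq t.1 s.1).trans ?_
    exact abs_of_nonneg (sub_nonneg.2 (NNReal.coe_le_coe.2 hst))
  rw [h2] at h
  exact h

theorem IsBrownianFamily.lintegral_incrementNormSq_pow_le (hβ : IsBrownianFamily P ℱ β)
    (Q : TraceClassCov) (hst : s ≤ t) {p : ℕ} (hp : 1 ≤ p) :
    ∫⁻ ω, incrementNormSq Q β s t ω ^ p ∂P
      ≤ ENNReal.ofReal Q.trace ^ p * ((t - s : ℝ≥0) ^ p * gaussianMoment p) := by
  have hm : ∀ j, Measurable fun ω => β j t ω - β j s ω := fun j =>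
    (measurable_increment β s t j).mono (hβ.increment_le s t) le_rfl
  have hmp : ∀ j, Measurable fun ω => ENNReal.ofReal ((β j t ω - β j s ω) ^ 2) ^ p := fun j =>
    ((hm j).pow_const 2).ennreal_ofReal.pow_const p
  have htr : ∑' j, ENNReal.ofReal (Q.q j) = ENNReal.ofReal Q.trace :=
    (ENNReal.ofReal_tsum_of_nonneg Q.nonneg Q.summable).symm
  have hmom : ∀ j, ∫⁻ ω, ENNReal.ofReal ((β j t ω - β j s ω) ^ 2) ^ p ∂P
      = (t - s : ℝ≥0) ^ p * gaussianMoment p := by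
    intro j
    rw [← lintegral_gaussianReal_pow,
      ← (hβ.hasLaw_increment hst j).lintegral_comp (f := fun x => ENNReal.ofReal (x ^ 2) ^ p)
        (by fun_prop)]
  calc ∫⁻ ω, incrementNormSq Q β s t ω ^ p ∂P
      ≤ ∫⁻ ω, ENNReal.ofReal Q.trace ^ (p - 1) * ∑' j, ENNReal.ofReal (Q.q j) *
          ENNReal.ofReal ((β j t ω - β j s ω) ^ 2) ^ p ∂P := by
        refine lintegral_mono fun ω => ?_
        rw [← htr]
        exact tsum_mul_pow_le _ _ hp
    _ = ENNReal.ofReal Q.trace ^ (p - 1) * ∑' j, ENNReal.ofReal (Q.q j) *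
          ((t - s : ℝ≥0) ^ p * gaussianMoment p) := by
        rw [lintegral_const_mul _ (Measurable.tsum fun j => (hmp j).const_mul _),
          lintegral_tsum fun j => ((hmp j).const_mul _).aemeasurable]
        congr 1
        refine tsum_congr fun j => ?_
        rw [lintegral_const_mul _ (hmp j), hmom]
    _ = _ := by
        rw [ENNReal.tsum_mul_right, htr, ← mul_assoc, ← pow_succ, Nat.sub_add_cancel hp]

theorem IsBrownianFamily.lintegral_mul_eq (hβ : IsBrownianFamily P ℱ β) (hst : s ≤ t)
    {V D : Ω → ℝ≥0∞} (hV : Measurable[ℱ s] V) (hD : Measurable[incrementAlgebra β s t] D) :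
    ∫⁻ ω, V ω * D ω ∂P = (∫⁻ ω, V ω ∂P) * ∫⁻ ω, D ω ∂P :=
  lintegral_mul_eq_lintegral_mul_lintegral_of_independent_measurableSpace (ℱ.le s)
    (hβ.increment_le s t) (hβ.indep_past s t hst).symm hV hD

/-- Series of Brownian increments with coefficients from the past have mean zero. -/
theorem IsBrownianFamily.integral_eq_zero [IsProbabilityMeasure P] (hβ : IsBrownianFamily P ℱ β)
    (hst : s ≤ t)
    {Y : ℕ → Ω → ℝ} (hY : ∀ j, Measurable[ℱ s] (Y j)) (hYi : ∀ j, Integrable (Y j) P)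
    {M bd : Ω → ℝ} (hbd : Integrable bd P)
    (hdom : ∀ J, ∀ᵐ ω ∂P, ‖∑ j ∈ Finset.range J, Y j ω * (β j t ω - β j s ω)‖ ≤ bd ω)
    (hlim : ∀ᵐ ω ∂P, Filter.Tendsto
      (fun J => ∑ j ∈ Finset.range J, Y j ω * (β j t ω - β j s ω)) Filter.atTop (nhds (M ω))) :
    Integrable M P ∧ ∫ ω, M ω ∂P = 0 := by
  have hm : ∀ j, Measurable fun ω => β j t ω - β j s ω := fun j =>
    (measurable_increment β s t j).mono (hβ.increment_le s t) le_rfl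
  have hYm : ∀ j, Measurable (Y j) := fun j => (hY j).mono (ℱ.le s) le_rfl
  have hind : ∀ j, IndepFun (Y j) (fun ω => β j t ω - β j s ω) P := by
    intro j
    rw [IndepFun_iff_Indep]
    exact indep_of_indep_of_le_left (indep_of_indep_of_le_right (hβ.indep_past s t hst).symm
      (measurable_increment β s t j).comap_le) (hY j).comap_le
  have hint : ∀ j, Integrable (fun ω => β j t ω - β j s ω) P := fun j =>
    ((hβ.brownian j).toIsPreBrownianReal.integrable_eval t).sub
      ((hβ.brownian j).toIsPreBrownianReal.integrable_eval s)
  have hzero : ∀ j, ∫ ω, Y j ω * (β j t ω - β j s ω) ∂P = 0 := by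
    intro j
    have h := (hind j).integral_mul_eq_mul_integral (hYm j).aestronglyMeasurable
      (hm j).aestronglyMeasurable
    have h0 : ∫ ω, (β j t ω - β j s ω) ∂P = 0 := by
      rw [(hβ.hasLaw_increment hst j).integral_eq, integral_id_gaussianReal]
    rw [h0, mul_zero] at h
    exact h
  have hsum : ∀ J, ∫ ω, ∑ j ∈ Finset.range J, Y j ω * (β j t ω - β j s ω) ∂P = 0 := by
    intro J
    rw [integral_finsetSum (f := fun j ω => Y j ω * (β j t ω - β j s ω)) _
      fun j _ => (hind j).integrable_mul (hYi j) (hint j)]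
    exact Finset.sum_eq_zero fun j _ => hzero j
  have hF : ∀ J, AEStronglyMeasurable
      (fun ω => ∑ j ∈ Finset.range J, Y j ω * (β j t ω - β j s ω)) P := fun J =>
    (Finset.measurable_fun_sum (Finset.range J)
      fun j _ => (hYm j).mul (hm j)).aestronglyMeasurable
  refine ⟨hbd.mono' (aestronglyMeasurable_of_tendsto_ae _ hF hlim) ?_, ?_⟩
  · filter_upwards [ae_all_iff.2 hdom, hlim] with ω h1 h2
    exact le_of_tendsto' h2.norm h1
  -- Every partial sum has mean zero, and domination passes this to the limit.
  have h := tendsto_integral_of_dominated_convergence bd hF hbd hdom hlim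
  simp only [hsum] at h
  exact tendsto_nhds_unique h tendsto_const_nhds

end Increments


/-! ### Growth of moments over one step -/

section OneStep

variable {Ω : Type u} [mΩ : MeasurableSpace Ω] {P : Measure Ω} {ℱ : Filtration ℝ≥0 mΩ}
  {β : ℕ → ℝ≥0 → Ω → ℝ} {s t : ℝ≥0} {Q : TraceClassCov}

theorem ae_ofReal_norm_sq_eq {w : Ω → VecL2}
    (hw : ∀ᵐ ω ∂P, HasSum (fun j => (Real.sqrt (Q.q j) * (β j t ω - β j s ω)) • Q.e j) (w ω)) :
    ∀ᵐ ω ∂P, ENNReal.ofReal (‖w ω‖ ^ 2) = incrementNormSq Q β s t ω := by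
  filter_upwards [hw] with ω h
  have h1 := hasSum_sq_of_orthonormal Q.e.orthonormal h
  rw [← h1.tsum_eq, ENNReal.ofReal_tsum_of_nonneg (fun j => sq_nonneg _) h1.summable]
  refine tsum_congr fun j => ?_
  rw [mul_pow, Real.sq_sqrt (Q.nonneg j), ENNReal.ofReal_mul (Q.nonneg j)]

/-- The noise term `R (g(v) w, v)` has mean zero if `R` and `v` belong to the past. -/
theorem IsBrownianFamily.integrable_noise [IsProbabilityMeasure P]
    (hβ : IsBrownianFamily P ℱ β) (hst : s ≤ t) {g : VecL2 → MatLinf} {Cg : ℝ}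
    (hg : NoiseAssumption Q g Cg) {v : Ω → VecL2} (hv : StronglyMeasurable[ℱ s] v)
    (hvH : ∀ᵐ ω ∂P, v ω ∈ spaceH) {R : Ω → ℝ} (hR : Measurable[ℱ s] R) {w : Ω → VecL2}
    (hw : ∀ᵐ ω ∂P, HasSum (fun j => (Real.sqrt (Q.q j) * (β j t ω - β j s ω)) • Q.e j) (w ω))
    (h1 : Integrable (fun ω => |R ω| * ‖v ω‖) P)
    (h2 : Integrable (fun ω => |R ω| * ‖v ω‖ * ‖w ω‖) P) :
    Integrable (fun ω => R ω * inner ℝ (nemytskii (g (v ω)) (w ω)) (v ω)) P ∧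
      ∫ ω, R ω * inner ℝ (nemytskii (g (v ω)) (w ω)) (v ω) ∂P = 0 := by
  let _ : MeasurableSpace VecL2 := borel VecL2
  have : BorelSpace VecL2 := ⟨rfl⟩
  have hCg := hg.pos
  let F : VecL2 → VecL2 → ℝ := fun χ =>
    spaceH.indicator fun v => (inner ℝ (nemytskii (g v) χ) v : ℝ)
  have hF : ∀ χ, Measurable (F χ) := fun χ => hg.measurable_indicator_inner χ
  have hFle : ∀ z ∈ spaceH, ∀ χ, |(inner ℝ (nemytskii (g z) χ) z : ℝ)| ≤ Cg * ‖χ‖ * ‖z‖ := by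
    intro z hz χ
    refine (abs_real_inner_le_norm _ _).trans ?_
    gcongr
    exact (norm_nemytskii_le _ _).trans (by gcongr; exact hg.bounded z hz)
  -- These are the coefficients of the noise term along the eigenbasis; extension by zero makes them
  -- measurable even at outcomes where `v` leaves `𝐇`.
  let Y : ℕ → Ω → ℝ := fun j ω => R ω * (Real.sqrt (Q.q j) * F (Q.e j) (v ω))
  have hY : ∀ j, Measurable[ℱ s] (Y j) := fun j =>
    hR.mul (((hF _).comp hv.measurable).const_mul _)
  have hYi : ∀ j, Integrable (Y j) P := by
    intro j
    refine (h1.const_mul (Real.sqrt (Q.q j) * Cg)).mono'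
      ((hY j).mono (ℱ.le s) le_rfl).aestronglyMeasurable ?_
    filter_upwards [hvH] with ω hω
    have h3 := hFle _ hω (Q.e j)
    rw [Q.e.orthonormal.1 j, mul_one] at h3
    simp only [Y, F, Set.indicator_of_mem hω, Real.norm_eq_abs, abs_mul,
      abs_of_nonneg (Real.sqrt_nonneg _)]
    calc _ ≤ |R ω| * (Real.sqrt (Q.q j) * (Cg * ‖v ω‖)) := by gcongr
      _ = _ := by ring
  have hsum : ∀ J, ∀ ω, v ω ∈ spaceH →
      ∑ j ∈ Finset.range J, Y j ω * (β j t ω - β j s ω) = R ω * inner ℝ (nemytskii (g (v ω))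
        (∑ j ∈ Finset.range J, (Real.sqrt (Q.q j) * (β j t ω - β j s ω)) • Q.e j)) (v ω) := by
    intro J ω hω
    rw [← nemytskiiCLM_apply, map_sum, sum_inner, Finset.mul_sum]
    refine Finset.sum_congr rfl fun j _ => ?_
    rw [map_smul, inner_smul_left, nemytskiiCLM_apply]
    simp only [Y, F, Set.indicator_of_mem hω, RCLike.conj_to_real]
    ring
  -- Partial sums of an orthonormal series are bounded in norm by the full sum, so `Cg |R| ‖v‖ ‖w‖`
  -- dominates uniformly.
  refine hβ.integral_eq_zero hst hY hYi (h2.const_mul Cg) (fun J => ?_) ?_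
  · filter_upwards [hvH, hw] with ω hω hwω
    rw [hsum J ω hω, Real.norm_eq_abs, abs_mul]
    have h3 := hFle _ hω
      (∑ j ∈ Finset.range J, (Real.sqrt (Q.q j) * (β j t ω - β j s ω)) • Q.e j)
    have h4 := norm_sum_le_of_orthonormal Q.e.orthonormal hwω (Finset.range J)
    calc _ ≤ |R ω| * (Cg * ‖w ω‖ * ‖v ω‖) := by
          gcongr
          exact h3.trans (by gcongr)
      _ = _ := by ring
  · filter_upwards [hvH, hw] with ω hω hwω
    simp_rw [fun J => hsum J ω hω, ← nemytskiiCLM_apply]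
    have h3 := hwω.tendsto_sum_nat
    exact ((((nemytskiiCLM (g (v ω))).continuous.tendsto _).comp h3).inner
      tendsto_const_nhds).const_mul (R ω)

/-- The moment of the noise that enters the growth factor of one step. -/
noncomputable def noiseMoment (P : Measure Ω) (Q : TraceClassCov) (β : ℕ → ℝ≥0 → Ω → ℝ) (s t : ℝ≥0)
    (Cg : ℝ) (p : ℕ) : ℝ≥0∞ :=
  ∫⁻ ω, (ENNReal.ofReal (Cg ^ 2) * incrementNormSq Q β s t ω
    + (ENNReal.ofReal (Cg ^ 2) * incrementNormSq Q β s t ω) ^ p) ∂P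

/-- The higher moment scales like `(t - s) ^ p`; writing this as at most `T ^ (p - 1) * (t - s)`
makes the bound linear in the step, as Gronwall requires, without any restriction on the step size.
-/
theorem IsBrownianFamily.noiseMoment_le (hβ : IsBrownianFamily P ℱ β) (hst : s ≤ t) {T : ℝ≥0}
    (hT : t - s ≤ T) (Cg : ℝ) {p : ℕ} (hp : 1 ≤ p) :
    noiseMoment P Q β s t Cg p ≤
      (ENNReal.ofReal (Cg ^ 2) * ENNReal.ofReal Q.trace * gaussianMoment 1
        + (ENNReal.ofReal (Cg ^ 2) * ENNReal.ofReal Q.trace) ^ p * T ^ (p - 1)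
          * gaussianMoment p) * (t - s : ℝ≥0) := by
  have hD : Measurable (incrementNormSq Q β s t) :=
    (measurable_incrementNormSq Q β s t).mono (hβ.increment_le s t) le_rfl
  have h1 := hβ.lintegral_incrementNormSq_pow_le Q hst le_rfl
  have h2 := hβ.lintegral_incrementNormSq_pow_le Q hst hp
  simp only [pow_one] at h1
  have hτ : ((t - s : ℝ≥0) : ℝ≥0∞) ^ p ≤ T ^ (p - 1) * (t - s : ℝ≥0) := by
    conv_lhs => rw [← Nat.sub_add_cancel hp, pow_succ]
    gcongr
  rw [noiseMoment, lintegral_add_left (hD.const_mul _), lintegral_const_mul _ hD]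
  simp_rw [mul_pow]
  rw [lintegral_const_mul _ (hD.pow_const p)]
  calc _ ≤ ENNReal.ofReal (Cg ^ 2) *
          (ENNReal.ofReal Q.trace * ((t - s : ℝ≥0) * gaussianMoment 1))
        + ENNReal.ofReal (Cg ^ 2) ^ p *
          (ENNReal.ofReal Q.trace ^ p * (T ^ (p - 1) * (t - s : ℝ≥0) * gaussianMoment p)) := by
        gcongr
        exact h2.trans (by gcongr)
    _ = _ := by ring

/-- One step of a multiplicative recursion driven by centred noise: growth of the `m`-th moment. -/
theorem IsBrownianFamily.lintegral_rpow_step_le [IsProbabilityMeasure P]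
    (hβ : IsBrownianFamily P ℱ β) (hst : s ≤ t) {g : VecL2 → MatLinf} {Cg : ℝ}
    (hg : NoiseAssumption Q g Cg) {v : Ω → VecL2} (hv : StronglyMeasurable[ℱ s] v)
    (hvH : ∀ᵐ ω ∂P, v ω ∈ spaceH) {r : Ω → ℝ} (hr : Measurable[ℱ s] r) {w : Ω → VecL2}
    (hwm : AEStronglyMeasurable w P)
    (hw : ∀ᵐ ω ∂P, HasSum (fun j => (Real.sqrt (Q.q j) * (β j t ω - β j s ω)) • Q.e j) (w ω))
    {Ψ Ψ' : Ω → ℝ} (hΨm : Measurable[ℱ s] Ψ) (hΨ : ∀ ω, 0 < Ψ ω) (hΨ' : ∀ ω, 0 < Ψ' ω)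
    (hrΨ : ∀ ω, |r ω| * ‖v ω‖ ≤ Ψ ω)
    {m K : ℝ} {p : ℕ} (hK : 0 ≤ K) (hstep : ∀ᵐ ω ∂P, Ψ' ω ^ m ≤ Ψ ω ^ m
      + m * (Ψ ω ^ (m - 1) * (r ω * inner ℝ (nemytskii (g (v ω)) (w ω)) (v ω)))
      + K * (Ψ ω ^ m * ((Cg * ‖w ω‖) ^ 2 + (Cg * ‖w ω‖) ^ (2 * p))))
    (hB : noiseMoment P Q β s t Cg p < ∞) :
    ∫⁻ ω, ENNReal.ofReal (Ψ' ω ^ m) ∂P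
      ≤ (1 + ENNReal.ofReal K * noiseMoment P Q β s t Cg p) *
        ∫⁻ ω, ENNReal.ofReal (Ψ ω ^ m) ∂P := by
  have hCg := hg.pos
  -- An infinite moment makes the claim trivial, since the growth factor is at least `1`; otherwise
  -- Bochner integrals are available.
  rcases eq_or_ne (∫⁻ ω, ENNReal.ofReal (Ψ ω ^ m) ∂P) ∞ with htop | hfin
  · rw [htop, ENNReal.mul_top (by simp)]; exact le_top
  have hΨr : Measurable[ℱ s] fun ω => Ψ ω ^ m := hΨm.pow_const m
  have hΨpos : ∀ ω, 0 < Ψ ω ^ m := fun ω => Real.rpow_pos_of_pos (hΨ ω) m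
  have hΨi : Integrable (fun ω => Ψ ω ^ m) P := by
    refine (lintegral_ofReal_ne_top_iff_integrable
      (hΨr.mono (ℱ.le s) le_rfl).aestronglyMeasurable ?_).1 hfin
    exact .of_forall fun ω => (hΨpos ω).le
  let b : Ω → ℝ := fun ω => (Cg * ‖w ω‖) ^ 2 + (Cg * ‖w ω‖) ^ (2 * p)
  have hb0 : ∀ ω, 0 ≤ b ω := fun ω => by positivity
  have hbm : AEStronglyMeasurable b P :=
    ((hwm.norm.const_mul Cg).pow 2).add ((hwm.norm.const_mul Cg).pow (2 * p))
  -- Almost surely `b` is a function of the Brownian increments, by Parseval, hence independent of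
  -- the past variable `Ψ ^ m`.
  have hprod : ∫⁻ ω, ENNReal.ofReal (Ψ ω ^ m * b ω) ∂P
      = (∫⁻ ω, ENNReal.ofReal (Ψ ω ^ m) ∂P) * noiseMoment P Q β s t Cg p := by
    have hDm : Measurable[incrementAlgebra β s t] fun ω =>
        ENNReal.ofReal (Cg ^ 2) * incrementNormSq Q β s t ω
          + (ENNReal.ofReal (Cg ^ 2) * incrementNormSq Q β s t ω) ^ p :=
      ((measurable_incrementNormSq Q β s t).const_mul _).add
        (((measurable_incrementNormSq Q β s t).const_mul _).pow_const p)
    rw [noiseMoment, ← hβ.lintegral_mul_eq hst hΨr.ennreal_ofReal hDm]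
    refine lintegral_congr_ae ?_
    filter_upwards [ae_ofReal_norm_sq_eq hw] with ω hω
    have h1 : 0 ≤ Cg ^ 2 * ‖w ω‖ ^ 2 := by positivity
    rw [ENNReal.ofReal_mul (hΨpos ω).le, ← hω, ← ENNReal.ofReal_mul (sq_nonneg Cg),
      ← ENNReal.ofReal_pow h1, ← ENNReal.ofReal_add h1 (by positivity)]
    simp only [b, pow_mul, mul_pow]
  have hbi : Integrable (fun ω => Ψ ω ^ m * b ω) P := by
    refine (lintegral_ofReal_ne_top_iff_integrable (f := fun ω => Ψ ω ^ m * b ω)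
      (hΨi.aestronglyMeasurable.mul hbm) ?_).1 ?_
    · exact .of_forall fun ω => mul_nonneg (hΨpos ω).le (hb0 ω)
    · rw [hprod]; exact ENNReal.mul_ne_top hfin hB.ne
  have hRle : ∀ ω, |Ψ ω ^ (m - 1) * r ω| * ‖v ω‖ ≤ Ψ ω ^ m := by
    intro ω
    have h1 : 0 < Ψ ω ^ (m - 1) := Real.rpow_pos_of_pos (hΨ ω) _
    rw [abs_mul, abs_of_pos h1, mul_assoc]
    calc _ ≤ Ψ ω ^ (m - 1) * Ψ ω := by gcongr; exact hrΨ ω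
      _ = Ψ ω ^ m := by rw [Real.rpow_sub_one (hΨ ω).ne', div_mul_cancel₀ _ (hΨ ω).ne']
  have hRm : Measurable[ℱ s] fun ω => Ψ ω ^ (m - 1) * r ω := (hΨm.pow_const _).mul hr
  have hvm : AEStronglyMeasurable v P := (hv.mono (ℱ.le s)).aestronglyMeasurable
  have hRa : AEStronglyMeasurable (fun ω => |Ψ ω ^ (m - 1) * r ω| * ‖v ω‖) P :=
    ((hRm.mono (ℱ.le s) le_rfl).aestronglyMeasurable.norm).mul hvm.norm
  have h1 : Integrable (fun ω => |Ψ ω ^ (m - 1) * r ω| * ‖v ω‖) P := by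
    refine hΨi.mono' hRa (.of_forall fun ω => ?_)
    rw [Real.norm_eq_abs, abs_of_nonneg (by positivity)]
    exact hRle ω
  have h2 : Integrable (fun ω => |Ψ ω ^ (m - 1) * r ω| * ‖v ω‖ * ‖w ω‖) P := by
    refine (hΨi.add (hbi.const_mul (Cg ^ 2)⁻¹)).mono' (hRa.mul hwm.norm) (.of_forall fun ω => ?_)
    rw [Real.norm_eq_abs, abs_of_nonneg (by positivity)]
    -- The first power of the noise is controlled by `1 + ‖w‖²`, so integrability of the martingale
    -- term follows from that of the remainder.
    have h3 : ‖w ω‖ ≤ 1 + (Cg ^ 2)⁻¹ * b ω := by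
      have h4 : ‖w ω‖ ^ 2 ≤ (Cg ^ 2)⁻¹ * b ω := by
        rw [le_inv_mul_iff₀ (by positivity), ← mul_pow]
        exact le_add_of_nonneg_right (by positivity)
      nlinarith only [h4, sq_nonneg (‖w ω‖ - 1), sq_nonneg (‖w ω‖)]
    calc _ ≤ Ψ ω ^ m * (1 + (Cg ^ 2)⁻¹ * b ω) := by
          gcongr
          · exact (hΨpos ω).le
          · exact hRle ω
      _ = _ := by simp only [Pi.add_apply]; ring
  obtain ⟨hNi, hN0⟩ := hβ.integrable_noise hst hg hv hvH hRm hw h1 h2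
  simp_rw [mul_assoc (_ ^ (m - 1))] at hNi hN0
  have hΨN : Integrable (fun ω => Ψ ω ^ m
      + m * (Ψ ω ^ (m - 1) * (r ω * inner ℝ (nemytskii (g (v ω)) (w ω)) (v ω)))) P :=
    hΨi.add (hNi.const_mul m)
  have hsum := hΨN.add (hbi.const_mul K)
  calc ∫⁻ ω, ENNReal.ofReal (Ψ' ω ^ m) ∂P
      ≤ ∫⁻ ω, ENNReal.ofReal (Ψ ω ^ m
      + m * (Ψ ω ^ (m - 1) * (r ω * inner ℝ (nemytskii (g (v ω)) (w ω)) (v ω)))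
      + K * (Ψ ω ^ m * b ω)) ∂P := by
        refine lintegral_mono_ae ?_
        filter_upwards [hstep] with ω hω
        exact ENNReal.ofReal_le_ofReal hω
    _ = ENNReal.ofReal (∫ ω, (Ψ ω ^ m
      + m * (Ψ ω ^ (m - 1) * (r ω * inner ℝ (nemytskii (g (v ω)) (w ω)) (v ω)))
      + K * (Ψ ω ^ m * b ω)) ∂P) := by
        refine (ofReal_integral_eq_lintegral_ofReal hsum ?_).symm
        filter_upwards [hstep] with ω hω
        exact (Real.rpow_pos_of_pos (hΨ' ω) m).le.trans hω
    _ = ENNReal.ofReal ((∫ ω, Ψ ω ^ m ∂P) + K * ∫ ω, Ψ ω ^ m * b ω ∂P) := by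
        rw [integral_add hΨN (hbi.const_mul K),
          integral_add hΨi (hNi.const_mul m), integral_const_mul, integral_const_mul, hN0,
          mul_zero, add_zero]
    _ = ENNReal.ofReal (∫ ω, Ψ ω ^ m ∂P)
          + ENNReal.ofReal K * ENNReal.ofReal (∫ ω, Ψ ω ^ m * b ω ∂P) := by
        rw [ENNReal.ofReal_add (integral_nonneg fun ω => (hΨpos ω).le)
          (mul_nonneg hK (integral_nonneg fun ω => mul_nonneg (hΨpos ω).le (hb0 ω))),
          ENNReal.ofReal_mul hK]
    _ = _ := by
        rw [ofReal_integral_eq_lintegral_ofReal hΨi (.of_forall fun ω => (hΨpos ω).le),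
          ofReal_integral_eq_lintegral_ofReal hbi
            (.of_forall fun ω => mul_nonneg (hΨpos ω).le (hb0 ω)), hprod]
        ring

end OneStep


/-! ### The energy of the scheme and its recursion -/

/-- The energy of the scheme at level `n`, including the accumulated dissipation. -/
noncomputable def energy {Ω : Type u} (τ : ℝ≥0) (X : SchemeVars Ω) (n : ℕ) (ω : Ω) : ℝ :=
  1 + ‖X.u n ω‖ ^ 2 + (τ : ℝ) ^ 2 * ‖X.gradP n ω‖ ^ 2 + X.ξ n ω ^ 2 + X.η n ω ^ 2
    + 2 * (τ * ∑ j ∈ Finset.range n, ‖X.gradUTilde (j + 1) ω‖ ^ 2)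

/-- The constant `1` in the energy serves this bound: the coefficient of the noise remainder is
absorbed by the energy itself, so the recursion is purely multiplicative. -/
theorem one_add_le_energy {Ω : Type u} (τ : ℝ≥0) (X : SchemeVars Ω) (n : ℕ) (ω : Ω) :
    1 + ‖X.u n ω‖ ^ 2 + X.η n ω ^ 2 ≤ energy τ X n ω := by
  have h1 : 0 ≤ (τ : ℝ) ^ 2 * ‖X.gradP n ω‖ ^ 2 := by positivity
  have h2 : 0 ≤ (τ : ℝ) * ∑ j ∈ Finset.range n, ‖X.gradUTilde (j + 1) ω‖ ^ 2 := by positivity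
  unfold energy
  linarith [sq_nonneg (X.ξ n ω)]

theorem energy_pos {Ω : Type u} (τ : ℝ≥0) (X : SchemeVars Ω) (n : ℕ) (ω : Ω) :
    0 < energy τ X n ω :=
  lt_of_lt_of_le (by positivity) (one_add_le_energy τ X n ω)

theorem abs_mul_norm_le_energy {Ω : Type u} (τ : ℝ≥0) (X : SchemeVars Ω) (n : ℕ) (ω : Ω) :
    |2 * X.η n ω| * ‖X.u n ω‖ ≤ energy τ X n ω := by
  refine le_trans ?_ (one_add_le_energy τ X n ω)
  rw [abs_mul, abs_two, ← sq_abs (X.η n ω)]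
  nlinarith only [sq_nonneg (|X.η n ω| - ‖X.u n ω‖)]

/-- Past dissipation is added to both sides of the one-step inequality, and the new dissipation
`2τ‖∇ũ‖²` extends the sum by one term. -/
theorem SchemeStep.energy_succ_le {Ω : Type u} {g : VecL2 → MatLinf} {W : ℝ≥0 → Ω → VecL2}
    {τ : ℝ≥0} {X : SchemeVars Ω} {n : ℕ} {ω : Ω} (h : SchemeStep g W τ X n ω)
    (hp : IsScalarGrad (X.p (n + 1) ω) (X.gradP (n + 1) ω)) {Cg : ℝ} (hg : ‖g (X.u n ω)‖ ≤ Cg) :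
    energy τ X (n + 1) ω ≤ energy τ X n ω
      + 2 * X.η n ω * inner ℝ (nemytskii (g (X.u n ω))
            (W (gridTime τ (n + 1)) ω - W (gridTime τ n) ω)) (X.u n ω)
      + 2 * energy τ X n ω *
          ((Cg * ‖W (gridTime τ (n + 1)) ω - W (gridTime τ n) ω‖) ^ 2
            + (Cg * ‖W (gridTime τ (n + 1)) ω - W (gridTime τ n) ω‖) ^ 4) := by
  have h1 := h.energy_le hp hg
  have h2 := mul_le_mul_of_nonneg_right (one_add_le_energy τ X n ω)
    (by positivity : 0 ≤ (Cg * ‖W (gridTime τ (n + 1)) ω - W (gridTime τ n) ω‖) ^ 2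
      + (Cg * ‖W (gridTime τ (n + 1)) ω - W (gridTime τ n) ω‖) ^ 4)
  have h3 : energy τ X (n + 1) ω = 1 + (‖X.u (n + 1) ω‖ ^ 2
      + (τ : ℝ) ^ 2 * ‖X.gradP (n + 1) ω‖ ^ 2 + X.ξ (n + 1) ω ^ 2
      + X.η (n + 1) ω ^ 2 + 2 * τ * ‖X.gradUTilde (n + 1) ω‖ ^ 2)
      + 2 * (τ * ∑ j ∈ Finset.range n, ‖X.gradUTilde (j + 1) ω‖ ^ 2) := by
    rw [energy, Finset.sum_range_succ]; ring
  have h4 : energy τ X n ω = 1 + (‖X.u n ω‖ ^ 2 + (τ : ℝ) ^ 2 * ‖X.gradP n ω‖ ^ 2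
      + X.ξ n ω ^ 2 + X.η n ω ^ 2)
      + 2 * (τ * ∑ j ∈ Finset.range n, ‖X.gradUTilde (j + 1) ω‖ ^ 2) := by
    rw [energy]; ring
  linarith

theorem gridTime_mono (τ : ℝ≥0) {k n : ℕ} (h : k ≤ n) : gridTime τ k ≤ gridTime τ n := by
  unfold gridTime; gcongr

theorem gridTime_succ_sub (τ : ℝ≥0) (n : ℕ) : gridTime τ (n + 1) - gridTime τ n = τ := by
  unfold gridTime
  rw [Nat.cast_succ, add_mul, one_mul, add_tsub_cancel_left]

theorem IsSchemeSolution.measurable_energy {Ω : Type u} [mΩ : MeasurableSpace Ω] {P : Measure Ω}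
    {ℱ : Filtration ℝ≥0 mΩ} {g : VecL2 → MatLinf} {W : ℝ≥0 → Ω → VecL2} {τ : ℝ≥0} {N : ℕ}
    {u₀ : Ω → VecL2} {X : SchemeVars Ω} (hX : IsSchemeSolution P ℱ g W τ N u₀ X) {n : ℕ}
    (hn : n ≤ N) : Measurable[ℱ (gridTime τ n)] (energy τ X n) := by
  have hD : Measurable[ℱ (gridTime τ n)]
      fun ω => ∑ j ∈ Finset.range n, ‖X.gradUTilde (j + 1) ω‖ ^ 2 := by
    refine Finset.measurable_fun_sum _ fun j hj => ?_
    have hj' := Finset.mem_range.1 hj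
    exact ((hX.adapted_gradUTilde j (by omega)).norm.measurable.mono
      (ℱ.mono (gridTime_mono τ hj')) le_rfl).pow_const 2
  exact (((((hX.adapted_u n hn).norm.measurable.pow_const 2).const_add 1).add
    (((hX.adapted_gradP n hn).norm.measurable.pow_const 2).const_mul _)).add
    ((hX.adapted_xi n hn).pow_const 2)).add ((hX.adapted_eta n hn).pow_const 2) |>.add
    ((hD.const_mul _).const_mul _)

theorem IsSchemeSolution.ae_mem_spaceH {Ω : Type u} [mΩ : MeasurableSpace Ω] {P : Measure Ω}
    {ℱ : Filtration ℝ≥0 mΩ} {g : VecL2 → MatLinf} {W : ℝ≥0 → Ω → VecL2} {τ : ℝ≥0} {N : ℕ}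
    {u₀ : Ω → VecL2} {X : SchemeVars Ω} (hX : IsSchemeSolution P ℱ g W τ N u₀ X) {n : ℕ}
    (hn : n ≤ N) : ∀ᵐ ω ∂P, X.u n ω ∈ spaceH := by
  cases n with
  | zero =>
    filter_upwards [hX.init_u, hX.init_divFree] with ω h1 h2
    rw [h1]; exact h2
  | succ n =>
    filter_upwards [hX.step n hn] with ω h
    exact h.divFree

/-- The growth rate of the `m`-th moment of the energy. -/
theorem exists_lintegral_energy_step_le (T : ℝ≥0) {m : ℝ} (hm : 1 ≤ m) (Cg trQ : ℝ) :
    ∃ κ : ℝ≥0, ∀ (Ω : Type u) [mΩ : MeasurableSpace Ω] (P : Measure Ω) [IsProbabilityMeasure P]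
      (ℱ : Filtration ℝ≥0 mΩ) (Q : TraceClassCov) (W : ℝ≥0 → Ω → VecL2) (g : VecL2 → MatLinf),
      Q.trace = trQ → IsQWiener P ℱ Q W → NoiseAssumption Q g Cg →
      ∀ (τ : ℝ≥0) (N : ℕ), gridTime τ N ≤ T → ∀ (u₀ : Ω → VecL2) (X : SchemeVars Ω),
        IsSchemeSolution P ℱ g W τ N u₀ X → ∀ n < N,
          ∫⁻ ω, ENNReal.ofReal (energy τ X (n + 1) ω ^ m) ∂P
            ≤ (1 + κ * τ : ℝ≥0) * ∫⁻ ω, ENNReal.ofReal (energy τ X n ω ^ m) ∂P := by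
  obtain ⟨K, hK, p, hp, hrec⟩ := exists_rpow_step_le hm
  set A : ℝ≥0∞ := ENNReal.ofReal (Cg ^ 2) * ENNReal.ofReal trQ * gaussianMoment 1
    + (ENNReal.ofReal (Cg ^ 2) * ENNReal.ofReal trQ) ^ p * T ^ (p - 1) * gaussianMoment p with hA
  have hAtop : A ≠ ∞ := by
    have h1 := (gaussianMoment_lt_top 1).ne
    have h2 := (gaussianMoment_lt_top p).ne
    rw [hA]
    finiteness
  -- The rate is fixed before the probability space, the covariance and the step size, and involves
  -- only `T`, `m`, `Cg` and the trace.
  refine ⟨K.toNNReal * A.toNNReal, ?_⟩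
  intro Ω mΩ P _ ℱ Q W g hQ hW hg τ N hNT u₀ X hX n hn
  obtain ⟨hWm, β, hβ, hWβ⟩ := hW
  have hst : gridTime τ n ≤ gridTime τ (n + 1) := gridTime_mono τ n.le_succ
  have hτT : gridTime τ (n + 1) - gridTime τ n ≤ T :=
    tsub_le_self.trans ((gridTime_mono τ hn).trans hNT)
  have hB := hβ.noiseMoment_le (Q := Q) hst hτT Cg hp
  rw [gridTime_succ_sub, hQ, ← hA] at hB
  have hw : ∀ᵐ ω ∂P, HasSum (fun j => (Real.sqrt (Q.q j) *
      (β j (gridTime τ (n + 1)) ω - β j (gridTime τ n) ω)) • Q.e j)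
      (W (gridTime τ (n + 1)) ω - W (gridTime τ n) ω) := by
    filter_upwards [hWβ (gridTime τ (n + 1)), hWβ (gridTime τ n)] with ω h1 h2
    simpa only [mul_sub, sub_smul] using h1.sub h2
  have hwm : AEStronglyMeasurable
      (fun ω => W (gridTime τ (n + 1)) ω - W (gridTime τ n) ω) P :=
    (((hWm _).mono (ℱ.le _)).sub ((hWm _).mono (ℱ.le _))).aestronglyMeasurable
  have hstep := hβ.lintegral_rpow_step_le hst hg (hX.adapted_u n hn.le)
    (hX.ae_mem_spaceH hn.le) ((hX.adapted_eta n hn.le).const_mul 2) hwm hw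
    (hX.measurable_energy hn.le) (energy_pos τ X n) (energy_pos τ X (n + 1))
    (abs_mul_norm_le_energy τ X n) (m := m) hK (p := p) ?_
    (hB.trans_lt (ENNReal.mul_lt_top hAtop.lt_top ENNReal.coe_lt_top))
  · refine hstep.trans ?_
    gcongr
    rw [ENNReal.coe_add, ENNReal.coe_one, ENNReal.coe_mul, ENNReal.coe_mul,
      ENNReal.coe_toNNReal hAtop, mul_assoc]
    gcongr
    rfl
  · filter_upwards [hX.step n hn, hX.p_mem (n + 1) hn, hX.ae_mem_spaceH hn.le] with ω h1 h2 h3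
    have hgb := hg.bounded _ h3
    have hCg := hg.pos
    refine hrec _ _ _ (Cg * ‖W (gridTime τ (n + 1)) ω - W (gridTime τ n) ω‖) (energy_pos τ X n ω)
      (energy_pos τ X (n + 1) ω) (by positivity) ?_ (h1.energy_succ_le h2 hgb)
    rw [abs_mul]
    have h4 : |inner ℝ (nemytskii (g (X.u n ω))
        (W (gridTime τ (n + 1)) ω - W (gridTime τ n) ω)) (X.u n ω)| ≤
        Cg * ‖W (gridTime τ (n + 1)) ω - W (gridTime τ n) ω‖ * ‖X.u n ω‖ := by
      refine (abs_real_inner_le_norm _ _).trans ?_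
      gcongr
      exact (norm_nemytskii_le _ _).trans (by gcongr)
    calc _ ≤ |2 * X.η n ω| *
          (Cg * ‖W (gridTime τ (n + 1)) ω - W (gridTime τ n) ω‖ * ‖X.u n ω‖) := by gcongr
      _ = Cg * ‖W (gridTime τ (n + 1)) ω - W (gridTime τ n) ω‖ *
          (|2 * X.η n ω| * ‖X.u n ω‖) := by ring
      _ ≤ _ := by gcongr; exact abs_mul_norm_le_energy τ X n ω

/-! ### Powers of norms and the initial energy -/

theorem enorm_rpow_two_mul {E : Type*} [NormedAddCommGroup E] (x : E) {m : ℝ} (hm : 0 ≤ m) :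
    ‖x‖ₑ ^ (2 * m) = ENNReal.ofReal ((‖x‖ ^ 2) ^ m) := by
  rw [← ofReal_norm, ENNReal.rpow_mul, ENNReal.rpow_two,
    ← ENNReal.ofReal_pow (norm_nonneg x), ENNReal.ofReal_rpow_of_nonneg (by positivity) hm]

/-- The sum is at most three times its largest term. -/
theorem add_add_rpow_le {a b c m : ℝ} (ha : 0 ≤ a) (hb : 0 ≤ b) (hc : 0 ≤ c) (hm : 0 ≤ m) :
    (a + b + c) ^ m ≤ 3 ^ m * (a ^ m + b ^ m + c ^ m) := by
  have h : ∀ d, 0 ≤ d → d ^ m ≤ a ^ m + b ^ m + c ^ m → a + b + c ≤ 3 * d →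
      (a + b + c) ^ m ≤ 3 ^ m * (a ^ m + b ^ m + c ^ m) := by
    intro d hd h1 h2
    calc (a + b + c) ^ m ≤ (3 * d) ^ m := Real.rpow_le_rpow (by positivity) h2 hm
      _ = 3 ^ m * d ^ m := Real.mul_rpow (by norm_num) hd
      _ ≤ _ := by gcongr
  have ha' := Real.rpow_nonneg ha m
  have hb' := Real.rpow_nonneg hb m
  have hc' := Real.rpow_nonneg hc m
  rcases le_total a b with h1 | h1 <;> rcases le_total b c with h2 | h2 <;>
    rcases le_total a c with h3 | h3
  all_goals first
    | exact h a ha (by linarith) (by linarith)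
    | exact h b hb (by linarith) (by linarith)
    | exact h c hc (by linarith) (by linarith)

/-- As `ξ` and `η` start at `1`, the initial energy is `3 + ‖u₀‖² + τ²‖∇p⁰‖²`. One factor `3 ^ m` of
`9 ^ m` comes from splitting the sum, the other from the constant `3`. -/
theorem lintegral_energy_zero_le {Ω : Type u} [mΩ : MeasurableSpace Ω] {P : Measure Ω}
    [IsProbabilityMeasure P]
    {ℱ : Filtration ℝ≥0 mΩ} {g : VecL2 → MatLinf} {W : ℝ≥0 → Ω → VecL2} {τ : ℝ≥0} {N : ℕ}
    {u₀ : Ω → VecL2} {X : SchemeVars Ω} (hX : IsSchemeSolution P ℱ g W τ N u₀ X)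
    {m : ℝ} (hm : 0 ≤ m) :
    ∫⁻ ω, ENNReal.ofReal (energy τ X 0 ω ^ m) ∂P ≤
      ENNReal.ofReal (9 ^ m) * (1 + (∫⁻ ω, ‖u₀ ω‖ₑ ^ (2 * m) ∂P)
        + (τ : ℝ≥0∞) ^ (2 * m) * (∫⁻ ω, ‖X.gradP 0 ω‖ₑ ^ (2 * m) ∂P)) := by
  have hGm : Measurable fun ω => ‖X.gradP 0 ω‖ₑ ^ (2 * m) :=
    (((hX.adapted_gradP 0 N.zero_le).mono (ℱ.le _)).enorm).pow_const _
  calc ∫⁻ ω, ENNReal.ofReal (energy τ X 0 ω ^ m) ∂P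
      ≤ ∫⁻ ω, ENNReal.ofReal (9 ^ m) * (1 + ‖u₀ ω‖ₑ ^ (2 * m)
          + (τ : ℝ≥0∞) ^ (2 * m) * ‖X.gradP 0 ω‖ₑ ^ (2 * m)) ∂P := by
        refine lintegral_mono_ae ?_
        filter_upwards [hX.init_u, hX.init_xi, hX.init_eta] with ω h1 h2 h3
        have h4 : energy τ X 0 ω = 3 + ‖u₀ ω‖ ^ 2 + (τ : ℝ) ^ 2 * ‖X.gradP 0 ω‖ ^ 2 := by
          rw [energy, h1, h2, h3]; simp; ring
        have h5 := add_add_rpow_le (a := 3) (b := ‖u₀ ω‖ ^ 2)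
          (c := (τ : ℝ) ^ 2 * ‖X.gradP 0 ω‖ ^ 2) (by norm_num) (by positivity) (by positivity) hm
        have h6 : (1 : ℝ) ≤ 3 ^ m := Real.one_le_rpow (by norm_num) hm
        have h7 : (9 : ℝ) ^ m = 3 ^ m * 3 ^ m := by
          rw [← Real.mul_rpow (by norm_num) (by norm_num)]; norm_num
        have hτ : (τ : ℝ≥0∞) ^ (2 * m) = ENNReal.ofReal (((τ : ℝ) ^ 2) ^ m) := by
          have := enorm_rpow_two_mul (τ : ℝ) hm
          rwa [Real.enorm_of_nonneg τ.coe_nonneg, ENNReal.ofReal_coe_nnreal, Real.norm_eq_abs,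
            sq_abs] at this
        rw [enorm_rpow_two_mul _ hm, enorm_rpow_two_mul _ hm, hτ,
          ← ENNReal.ofReal_mul (by positivity), ← Real.mul_rpow (by positivity) (by positivity),
          ← ENNReal.ofReal_one, ← ENNReal.ofReal_add (by positivity) (by positivity),
          ← ENNReal.ofReal_add (by positivity) (by positivity),
          ← ENNReal.ofReal_mul (by positivity), h4, h7]
        refine ENNReal.ofReal_le_ofReal (h5.trans ?_)
        rw [mul_assoc]
        gcongr
        have h8 : 0 ≤ (‖u₀ ω‖ ^ 2) ^ m := by positivity
        have h9 : 0 ≤ ((τ : ℝ) ^ 2 * ‖X.gradP 0 ω‖ ^ 2) ^ m := by positivity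
        nlinarith only [h6, h8, h9, mul_nonneg (sub_nonneg.2 h6) h8,
          mul_nonneg (sub_nonneg.2 h6) h9]
    _ = _ := by
        rw [lintegral_const_mul' _ _ ENNReal.ofReal_ne_top,
          lintegral_add_right _ (hGm.const_mul _), lintegral_add_left measurable_const,
          lintegral_const_mul _ hGm]
        simp

end SAV

/-! ### Discrete Gronwall and conclusion -/

theorem mainTheorem2 (T : ℝ≥0) (m : ℝ) (hm : 1 ≤ m) (Cg trQ : ℝ) :
    ∃ C : ℝ≥0,
      ∀ (Ω : Type u) [mΩ : MeasurableSpace Ω] (P : Measure Ω) [IsProbabilityMeasure P]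
        (ℱ : Filtration ℝ≥0 mΩ) (Q : SAV.TraceClassCov) (W : ℝ≥0 → Ω → SAV.VecL2)
        (g : SAV.VecL2 → SAV.MatLinf),
        Q.trace = trQ →
        SAV.IsQWiener P ℱ Q W →
        SAV.NoiseAssumption Q g Cg →
        ∀ (τ : ℝ≥0) (N : ℕ), 0 < τ → SAV.gridTime τ N ≤ T →
        ∀ (u₀ : Ω → SAV.VecL2) (X : SAV.SchemeVars Ω),
          SAV.IsSchemeSolution P ℱ g W τ N u₀ X →
          ∀ n : ℕ, n < N →
            (∫⁻ ω, ‖X.u (n + 1) ω‖ₑ ^ (2 * m) ∂P)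
              + (∫⁻ ω, ENNReal.ofReal
                  (τ * ∑ j ∈ Finset.range (n + 1), ‖X.gradUTilde (j + 1) ω‖ ^ 2) ^ m ∂P)
              + (∫⁻ ω, ‖X.ξ (n + 1) ω‖ₑ ^ (2 * m) ∂P)
              + (∫⁻ ω, ‖X.η (n + 1) ω‖ₑ ^ (2 * m) ∂P)
              + (τ : ℝ≥0∞) ^ (2 * m) * (∫⁻ ω, ‖X.gradP (n + 1) ω‖ₑ ^ (2 * m) ∂P)
            ≤ C * (1 + (∫⁻ ω, ‖u₀ ω‖ₑ ^ (2 * m) ∂P)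
                + (τ : ℝ≥0∞) ^ (2 * m) * (∫⁻ ω, ‖X.gradP 0 ω‖ₑ ^ (2 * m) ∂P)) := by
  have hm0 : 0 ≤ m := by linarith
  obtain ⟨κ, hκ⟩ := SAV.exists_lintegral_energy_step_le.{u} T hm Cg trQ
  -- The factors are the number of quantities to bound, the Gronwall factor and the constant of the
  -- initial energy.
  refine ⟨5 * ((Real.exp (κ * T)).toNNReal * ((9 : ℝ) ^ m).toNNReal), ?_⟩
  intro Ω mΩ P _ ℱ Q W g hQ hW hg τ N hτ hNT u₀ X hX n hn
  have hstep := hκ Ω P ℱ Q W g hQ hW hg τ N hNT u₀ X hX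
  have hpow : ∀ k ≤ N, ∫⁻ ω, ENNReal.ofReal (SAV.energy τ X k ω ^ m) ∂P
      ≤ ((1 + κ * τ : ℝ≥0) : ℝ≥0∞) ^ k * ∫⁻ ω, ENNReal.ofReal (SAV.energy τ X 0 ω ^ m) ∂P := by
    intro k
    induction k with
    | zero => intro _; simp
    | succ k ih =>
      intro hk
      refine (hstep k hk).trans ?_
      rw [pow_succ', mul_assoc]
      gcongr
      exact ih (by omega)
  have hexp : (1 + κ * τ : ℝ≥0) ^ (n + 1) ≤ (Real.exp (κ * T)).toNNReal := by
    rw [← NNReal.coe_le_coe, Real.coe_toNNReal _ (Real.exp_pos _).le]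
    push_cast
    have h1 : ((n + 1 : ℕ) : ℝ) * τ ≤ T := by
      have := (SAV.gridTime_mono τ hn).trans hNT
      exact_mod_cast this
    calc (1 + (κ : ℝ) * τ) ^ (n + 1) ≤ Real.exp (κ * τ) ^ (n + 1) := by
          gcongr
          linarith [Real.add_one_le_exp ((κ : ℝ) * τ)]
      _ = Real.exp (κ * (((n + 1 : ℕ) : ℝ) * τ)) := by
          rw [← Real.exp_nat_mul]; congr 1; ring
      _ ≤ _ := by gcongr
  have hE : ∫⁻ ω, ENNReal.ofReal (SAV.energy τ X (n + 1) ω ^ m) ∂P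
      ≤ (Real.exp (κ * T)).toNNReal * (ENNReal.ofReal (9 ^ m) *
        (1 + (∫⁻ ω, ‖u₀ ω‖ₑ ^ (2 * m) ∂P)
          + (τ : ℝ≥0∞) ^ (2 * m) * (∫⁻ ω, ‖X.gradP 0 ω‖ₑ ^ (2 * m) ∂P))) := by
    refine (hpow (n + 1) hn).trans ?_
    gcongr
    · exact_mod_cast hexp
    · exact SAV.lintegral_energy_zero_le hX hm0
  have hD : ∀ ω, 0 ≤ (τ : ℝ) * ∑ j ∈ Finset.range (n + 1), ‖X.gradUTilde (j + 1) ω‖ ^ 2 :=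
    fun ω => by positivity
  have hG : ∀ ω, 0 ≤ (τ : ℝ) ^ 2 * ‖X.gradP (n + 1) ω‖ ^ 2 := fun ω => by positivity
  -- Each of the five quantities is the `m`-th moment of a nonnegative function bounded pointwise by
  -- the energy.
  have hmono : ∀ (f : Ω → ℝ), (∀ ω, 0 ≤ f ω) → (∀ ω, f ω ≤ SAV.energy τ X (n + 1) ω) →
      ∫⁻ ω, ENNReal.ofReal (f ω ^ m) ∂P ≤ ∫⁻ ω, ENNReal.ofReal (SAV.energy τ X (n + 1) ω ^ m) ∂P :=
    fun f h0 h1 => lintegral_mono fun ω =>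
      ENNReal.ofReal_le_ofReal (Real.rpow_le_rpow (h0 ω) (h1 ω) hm0)
  have e1 : ∫⁻ ω, ‖X.u (n + 1) ω‖ₑ ^ (2 * m) ∂P
      ≤ ∫⁻ ω, ENNReal.ofReal (SAV.energy τ X (n + 1) ω ^ m) ∂P := by
    simp_rw [SAV.enorm_rpow_two_mul _ hm0]
    refine hmono _ (fun ω => sq_nonneg _) fun ω => ?_
    unfold SAV.energy
    linarith [hD ω, hG ω, sq_nonneg (X.ξ (n + 1) ω), sq_nonneg (X.η (n + 1) ω)]
  have e2 : ∫⁻ ω, ENNReal.ofReal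
        (τ * ∑ j ∈ Finset.range (n + 1), ‖X.gradUTilde (j + 1) ω‖ ^ 2) ^ m ∂P
      ≤ ∫⁻ ω, ENNReal.ofReal (SAV.energy τ X (n + 1) ω ^ m) ∂P := by
    simp_rw [fun ω => ENNReal.ofReal_rpow_of_nonneg (hD ω) hm0]
    refine hmono _ hD fun ω => ?_
    unfold SAV.energy
    linarith [hD ω, hG ω, sq_nonneg (X.ξ (n + 1) ω), sq_nonneg (X.η (n + 1) ω),
      sq_nonneg ‖X.u (n + 1) ω‖]
  have e3 : ∫⁻ ω, ‖X.ξ (n + 1) ω‖ₑ ^ (2 * m) ∂P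
      ≤ ∫⁻ ω, ENNReal.ofReal (SAV.energy τ X (n + 1) ω ^ m) ∂P := by
    simp_rw [SAV.enorm_rpow_two_mul _ hm0, Real.norm_eq_abs, sq_abs]
    refine hmono _ (fun ω => sq_nonneg _) fun ω => ?_
    unfold SAV.energy
    linarith [hD ω, hG ω, sq_nonneg ‖X.u (n + 1) ω‖, sq_nonneg (X.η (n + 1) ω)]
  have e4 : ∫⁻ ω, ‖X.η (n + 1) ω‖ₑ ^ (2 * m) ∂P
      ≤ ∫⁻ ω, ENNReal.ofReal (SAV.energy τ X (n + 1) ω ^ m) ∂P := by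
    simp_rw [SAV.enorm_rpow_two_mul _ hm0, Real.norm_eq_abs, sq_abs]
    refine hmono _ (fun ω => sq_nonneg _) fun ω => ?_
    unfold SAV.energy
    linarith [hD ω, hG ω, sq_nonneg ‖X.u (n + 1) ω‖, sq_nonneg (X.ξ (n + 1) ω)]
  have e5 : (τ : ℝ≥0∞) ^ (2 * m) * ∫⁻ ω, ‖X.gradP (n + 1) ω‖ₑ ^ (2 * m) ∂P
      ≤ ∫⁻ ω, ENNReal.ofReal (SAV.energy τ X (n + 1) ω ^ m) ∂P := by
    rw [← lintegral_const_mul' _ _ (by finiteness)]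
    have h1 : ∀ ω, (τ : ℝ≥0∞) ^ (2 * m) * ‖X.gradP (n + 1) ω‖ₑ ^ (2 * m)
        = ENNReal.ofReal (((τ : ℝ) ^ 2 * ‖X.gradP (n + 1) ω‖ ^ 2) ^ m) := by
      intro ω
      rw [← ENNReal.mul_rpow_of_nonneg _ _ (by positivity), ← mul_pow,
        ← norm_smul_of_nonneg τ.coe_nonneg, ← SAV.enorm_rpow_two_mul _ hm0, enorm_smul,
        Real.enorm_of_nonneg τ.coe_nonneg, ENNReal.ofReal_coe_nnreal]
    simp_rw [h1]
    refine hmono _ hG fun ω => ?_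
    unfold SAV.energy
    linarith [hD ω, hG ω, sq_nonneg (X.ξ (n + 1) ω), sq_nonneg (X.η (n + 1) ω),
      sq_nonneg ‖X.u (n + 1) ω‖]
  refine (add_le_add (add_le_add (add_le_add (add_le_add e1 e2) e3) e4) e5).trans ?_
  rw [ENNReal.coe_mul, ENNReal.coe_mul, mul_assoc, mul_assoc]
  calc _ = 5 * ∫⁻ ω, ENNReal.ofReal (SAV.energy τ X (n + 1) ω ^ m) ∂P := by ring
    _ ≤ _ := mul_le_mul_right hE 5
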